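/- Let $N\ge 1$ and let $K:\mathbb{R}^N\to\mathbb{R}$ be a kernel with $K(x)=k(|x|)$ for $x\neq0$, where $k\in C^1(0,\infty)$, $k'\in L^\infty(0,\infty)$, $$\kappa_\Lambda:=-\sup_{s\in(0,\Lambda)}k'(s)\in(0,\infty)\ \text{ for every }\Lambda>0,\qquad \lim_{\Lambda\searrow0}\kappa_\Lambda\in(0,\infty),$$ and, if $N=1$, also $k''\in L^1(0,\infty)$ (in the sense of weak derivatives). Let $u_0\in L^1(\mathbb{R}^N)\cap L^\infty(\mathbb{R}^N)$ be radial and nonnegative, with $M:=\int_{\mathbb{R}^N}u_0\,dx>0$, and suppose that for some $\Lambda>0$ $$\mu_\Lambda:=\int_{\mathbb{R}^N}\min\{|x|,\Lambda\}\,u_0(x)\,dx<\frac{\kappa_\Lambda M}{4(\kappa_\Lambda+2\|k'\|_\infty)}\,\Lambda .$$ Then there are numbers $\varepsilon_*,T_*,C_*,\lambda>0$, independent of $\varepsilon$, such that for every $\varepsilon\in(0,\varepsilon_*)$ and every radial nonnegative global-in-time solution $u$ of $$u_t-\varepsilon\Delta u+\nabla\cdot(u\,\nabla K*u)=0\ \text{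 in }\mathbb{R}^N\times(0,\infty),\qquad u(\cdot,0)=u_0,$$ one has $$\int_0^{T_*}\int_{B_{\lambda\varepsilon}}u(x,t)\,dx\,dt\ge C_*,$$ where $B_r$ is the ball of radius $r$ centred at the origin. Here $\nabla K*u$ is the convolution of $u(\cdot,t)$ with the (bounded) function $\nabla K$, and a solution is a mild one: $u\in C([0,\infty);L^1(\mathbb{R}^N))$ and, for every $t>0$, $u(t)=G_{\varepsilon t}*u_0-\int_0^t\nabla G_{\varepsilon(t-s)}*\big(u\,\nabla K*u\big)(s)\,ds$ almost everywhere, with $G_\tau(x)=(4\pi\tau)^{-N/2}e^{-|x|^2/(4\tau)}$. -/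

import Mathlib

open MeasureTheory Set Filter Topology
open scoped ENNReal ContDiff

noncomputable section

namespace Aggregation

/-- The Euclidean space `ℝ^N`. -/
abbrev Space (N : ℕ) : Type := EuclideanSpace ℝ (Fin N)

/-- A (class of a) function on `ℝ^N` is radial if, up to a null set, it depends on `|x|` only. -/
def IsRadial {N : ℕ} (v : Space N → ℝ) : Prop :=
  ∃ f : ℝ → ℝ, ∀ᵐ x, v x = f ‖x‖

/-- The `L^∞(0,∞)` norm of the derivative `k'`. -/
def supNormDeriv (k : ℝ → ℝ) : ℝ :=
  (eLpNorm (deriv k) ∞ (volume.restrict (Ioi (0 : ℝ)))).toReal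

/-- `κ_Λ = - sup_{0 < s < Λ} k'(s)`. -/
def kappa (k : ℝ → ℝ) (Λ : ℝ) : ℝ :=
  -sSup (deriv k '' Ioo 0 Λ)

/-- `K(x) = k(|x|)` for `x ≠ 0`, with `k ∈ C¹(0,∞)` and `k' ∈ L^∞(0,∞)`. -/
structure IsRadialKernel {N : ℕ} (K : Space N → ℝ) (k : ℝ → ℝ) : Prop where
  eq_profile : ∀ x, x ≠ 0 → K x = k ‖x‖
  contDiffOn : ContDiffOn ℝ 1 k (Ioi 0)
  deriv_memLp : MemLp (deriv k) ∞ (volume.restrict (Ioi (0 : ℝ)))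

/-- Attractivity with a mild singularity at the origin: `κ_Λ > 0` for each `Λ > 0`, and
`κ_Λ` has a finite positive limit as `Λ ↘ 0`. (Finiteness of `κ_Λ` is automatic for bounded `k'`.) -/
structure IsMildlySingular (k : ℝ → ℝ) : Prop where
  kappa_pos : ∀ Λ : ℝ, 0 < Λ → 0 < kappa k Λ
  kappa_zero : ∃ κ₀ : ℝ, 0 < κ₀ ∧ Tendsto (kappa k) (𝓝[>] 0) (𝓝 κ₀)

/-- `k'' ∈ L¹(0,∞)`: the function `k'` has a weak derivative `g` on `(0,∞)` that is integrable. -/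
def SecondDerivIntegrable (k : ℝ → ℝ) : Prop :=
  ∃ g : ℝ → ℝ, IntegrableOn g (Ioi 0) ∧
    ∀ ψ : ℝ → ℝ, ContDiff ℝ ∞ ψ → HasCompactSupport ψ → tsupport ψ ⊆ Ioi 0 →
      ∫ s in Ioi (0 : ℝ), deriv k s * deriv ψ s = -∫ s in Ioi (0 : ℝ), g s * ψ s

/-- The mass `∫ u₀ dx`. -/
def mass {N : ℕ} (u₀ : Space N → ℝ) : ℝ := ∫ x, u₀ x

/-- `u₀ ∈ L¹ ∩ L^∞`, `u₀ ≥ 0`, and `u₀` has positive mass. -/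
structure IsInitialDatum {N : ℕ} (u₀ : Space N → ℝ) : Prop where
  integrable : Integrable u₀
  bounded : MemLp u₀ ∞
  nonneg : 0 ≤ᵐ[volume] u₀
  mass_pos : 0 < mass u₀

/-- The truncated first moment `μ_Λ = ∫ min{|x|, Λ} u₀(x) dx`. -/
def truncatedMoment {N : ℕ} (u₀ : Space N → ℝ) (Λ : ℝ) : ℝ :=
  ∫ x, min ‖x‖ Λ * u₀ x

/-- The Gauss-Weierstrass kernel `(4πτ)^{-N/2} exp(-|x|²/(4τ))`. -/
def heatKernel {N : ℕ} (τ : ℝ) (x : Space N) : ℝ :=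
  (4 * Real.pi * τ) ^ (-(N : ℝ) / 2) * Real.exp (-‖x‖ ^ 2 / (4 * τ))

/-- The drift velocity `(∇K ∗ v)(x) = ∫ v(y) ∇K(x - y) dy`. -/
def drift {N : ℕ} (K : Space N → ℝ) (v : Space N → ℝ) (x : Space N) : Space N :=
  ∫ y, v y • gradient K (x - y)

/-- `u` is a global-in-time (mild) solution of
`u_t - ε Δu + ∇·(u ∇K∗u) = 0` on `ℝ^N × (0,∞)`, `u(0) = u₀`:
`u ∈ C([0,∞); L¹(ℝ^N))`, and for each `t > 0` the Duhamel formula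
`u(t) = G_{εt} ∗ u₀ - ∫_0^t ∇G_{ε(t-s)} ∗ (u ∇K∗u)(s) ds` holds almost everywhere,
where `G` is the heat kernel. Here `u t x` stands for `u(x,t)`. -/
structure IsSolution {N : ℕ} (ε : ℝ) (K : Space N → ℝ) (u₀ : Space N → ℝ)
    (u : ℝ → Space N → ℝ) : Prop where
  aestronglyMeasurable : AEStronglyMeasurable (Function.uncurry u)
    ((volume.restrict (Ici (0 : ℝ))).prod volume)
  integrable : ∀ t, 0 ≤ t → Integrable (u t)
  continuous_L1 : ∀ t₀, 0 ≤ t₀ →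
    Tendsto (fun t => ∫ x, |u t x - u t₀ x|) (𝓝[Ici 0] t₀) (𝓝 0)
  initial : u 0 =ᵐ[volume] u₀
  duhamel : ∀ t, 0 < t → ∀ᵐ x,
    u t x = (∫ y, heatKernel (ε * t) (x - y) * u₀ y)
      - ∫ s in (0 : ℝ)..t, ∫ y,
          inner ℝ (gradient (heatKernel (ε * (t - s))) (x - y)) (u s y • drift K (u s) y)

end Aggregation

end

noncomputable section

namespace Aggregation

open scoped FourierTransform RealInnerProductSpace SchwartzMap LineDeriv

variable {N : ℕ} {K : Space N → ℝ} {k : ℝ → ℝ}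

/-! Test the equation with a smoothed version `φ` of `min |x| Λ`, at smoothing scale `δ`, and follow
the moment `V(t) = ∫ u φ`. Write `L` for `supNormDeriv k`, `κ` for `kappa k Λ`, `M` for the
conserved mass and `e_x = x/|x|`. The diffusion contributes at most `ε N M / δ` to `V'`, because `Δφ
≤ N/δ`; this stays bounded as `ε → 0` exactly when `δ` is proportional to `ε`.

The drift term is a double integral over `(x, y)`, which is symmetrised. When both points lie in the
annulus `r ≤ |x| < Λ/2`, `∇φ` is close to `e_x` with error at most `δ/r`, and the identity `(e_x -
e_y)·(x - y) = (|x| + |y|)(1 - e_x·e_y)` with `|x| + |y| ≥ |x - y|` bounds the symmetrised integrand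
by `-κ (1 - e_x·e_y)` up to that error (`inner_direction_radialField_le`). The cross term `e_x·e_y`
integrates to zero since `u` is even. The drift therefore contributes `-κ M²/2`, up to the error in
`∇φ` and a multiple of the mass outside the annulus. That mass lies either in `B_r`, or where `φ ≥
Λ/2` and so is at most `(2/Λ) V` (`integral_inner_drift_le`, `IsTruncatedNorm.mass_compl_le`).

The result is `V' ≤ -D + A V + C ∫_{B_r} u` with constants free of `ε` and `r` proportional to `ε`
(`IsTruncatedNorm.exists_hasDerivAt`). The smallness of the truncated moment makes `-D + A V(0)`
negative with a margin. Without enough mass in `B_r`, Gronwall would force `V < 0` at a finite time,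
which is impossible as `V ≥ 0` (`le_const_mul_integral_of_deriv_le`).

Solutions are only mild, so the identity for `V'` needs proof. The Fourier transform turns Duhamel's
formula into a scalar linear ODE at each frequency, and pairing with a Schwartz function moves the
multipliers back onto the test function (`IsMildSolution.hasDerivAt_integral_mul`). -/

/-! ### Heat kernel: gradient bounds and Fourier transforms. -/

theorem heatKernel_nonneg {τ : ℝ} (hτ : 0 < τ) (x : Space N) : 0 ≤ heatKernel τ x := by
  unfold heatKernel; positivity

theorem integrable_rexp_neg_mul_sq_norm {b : ℝ} (hb : 0 < b) :
    Integrable (fun x : Space N => Real.exp (-b * ‖x‖ ^ 2)) := by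
  have h := (GaussianFourier.integrable_cexp_neg_mul_sq_norm_add (V := Space N)
    (b := (b : ℂ)) (by simpa using hb) 0 0).norm
  refine h.congr (ae_of_all _ fun x => ?_)
  simp [Complex.norm_exp, ← Complex.ofReal_pow]

theorem heatKernel_eq (τ : ℝ) (x : Space N) : heatKernel τ x =
    (4 * Real.pi * τ) ^ (-(N : ℝ) / 2) * Real.exp (-(1 / (4 * τ)) * ‖x‖ ^ 2) := by
  unfold heatKernel
  congr 2
  ring

theorem integrable_heatKernel {τ : ℝ} (hτ : 0 < τ) : Integrable (heatKernel (N := N) τ) := by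
  have := (integrable_rexp_neg_mul_sq_norm (N := N) (b := 1 / (4 * τ)) (by positivity)).const_mul
    ((4 * Real.pi * τ) ^ (-(N : ℝ) / 2))
  exact this.congr (ae_of_all _ fun x => (heatKernel_eq τ x).symm)

theorem integral_heatKernel {τ : ℝ} (hτ : 0 < τ) : ∫ x : Space N, heatKernel τ x = 1 := by
  simp_rw [heatKernel_eq, integral_const_mul]
  rw [GaussianFourier.integral_rexp_neg_mul_sq_norm (by positivity), finrank_euclideanSpace_fin,
    show Real.pi / (1 / (4 * τ)) = 4 * Real.pi * τ by field_simp,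
    ← Real.rpow_add (by positivity)]
  simp [neg_div]

theorem hasGradientAt_heatKernel {τ : ℝ} (x : Space N) :
    HasGradientAt (heatKernel τ) ((-(heatKernel τ x / (2 * τ))) • x) x := by
  rw [hasGradientAt_iff_hasFDerivAt]
  have h1 : HasFDerivAt (fun x : Space N => ‖x‖ ^ 2) (2 • innerSL ℝ x) x :=
    (hasStrictFDerivAt_norm_sq x).hasFDerivAt
  have h2 := ((h1.const_mul (-(1 / (4 * τ)))).exp).const_mul ((4 * Real.pi * τ) ^ (-(N : ℝ) / 2))
  have h3 : (fun x : Space N => (4 * Real.pi * τ) ^ (-(N : ℝ) / 2) *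
      Real.exp (-(1 / (4 * τ)) * ‖x‖ ^ 2)) = heatKernel τ := by
    funext x; rw [heatKernel_eq]
  rw [h3] at h2
  refine h2.congr_fderiv ?_
  ext v
  simp only [heatKernel_eq, InnerProductSpace.toDual_apply_apply, inner_smul_left]
  simp
  ring

theorem gradient_heatKernel (τ : ℝ) (x : Space N) :
    gradient (heatKernel τ) x = (-(heatKernel τ x / (2 * τ))) • x :=
  (hasGradientAt_heatKernel x).gradient

theorem continuous_heatKernel (τ : ℝ) : Continuous (heatKernel (N := N) τ) :=
  continuous_iff_continuousAt.2 fun x => (hasGradientAt_heatKernel x).differentiableAt.continuousAt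

theorem continuous_gradient_heatKernel (τ : ℝ) :
    Continuous (gradient (heatKernel (N := N) τ)) := by
  have : gradient (heatKernel (N := N) τ) = fun x => (-(heatKernel τ x / (2 * τ))) • x :=
    funext (gradient_heatKernel τ)
  rw [this]
  have := continuous_heatKernel (N := N) τ
  fun_prop

/-- Half of the Gaussian exponent absorbs the factor `|x|/(2τ)` at the cost of a multiple of
`τ^{-1/2}`; the other half is the kernel at time `2τ`, whose normalisation differs by `2^{N/2}`. The
singularity `τ^{-1/2}` is integrable in time. -/
theorem norm_gradient_heatKernel_le {τ : ℝ} (hτ : 0 < τ) (x : Space N) :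
    ‖gradient (heatKernel τ) x‖ ≤ 2 ^ ((N : ℝ) / 2) * (2 * (1 / √τ) * heatKernel (2 * τ) x) := by
  have hs : 0 < √τ := Real.sqrt_pos.2 hτ
  have hsq : √τ * √τ = τ := Real.mul_self_sqrt hτ.le
  have key : ‖x‖ * Real.exp (-(1 / (8 * τ)) * ‖x‖ ^ 2) ≤ 4 * √τ := by
    -- With `a = |x|/(4√τ)` the exponent is `2a²`, and `a ≤ 1 + 2a² ≤ exp (2a²)`.
    have h1 : ‖x‖ / (4 * √τ) ≤ Real.exp (1 / (8 * τ) * ‖x‖ ^ 2) := by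
      have h2 := Real.add_one_le_exp (1 / (8 * τ) * ‖x‖ ^ 2)
      refine le_trans ?_ h2
      have : 1 / (8 * τ) * ‖x‖ ^ 2 = 2 * (‖x‖ / (4 * √τ)) ^ 2 := by
        rw [div_pow, mul_pow, Real.sq_sqrt hτ.le]; field_simp; ring
      rw [this]
      nlinarith [sq_nonneg (‖x‖ / (4 * √τ) - 1 / 4)]
    rw [neg_mul, Real.exp_neg, ← div_eq_mul_inv, div_le_iff₀ (Real.exp_pos _)]
    rw [div_le_iff₀ (by positivity)] at h1
    linarith
  rw [gradient_heatKernel, norm_smul, norm_neg, Real.norm_of_nonneg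
    (div_nonneg (heatKernel_nonneg hτ x) (by positivity)), heatKernel_eq, heatKernel_eq]
  have h4 : (4 * Real.pi * (2 * τ)) ^ (-(N : ℝ) / 2) =
      (2 ^ ((N : ℝ) / 2))⁻¹ * (4 * Real.pi * τ) ^ (-(N : ℝ) / 2) := by
    rw [show 4 * Real.pi * (2 * τ) = 2 * (4 * Real.pi * τ) by ring,
      Real.mul_rpow (by positivity) (by positivity), neg_div, Real.rpow_neg (by positivity)]
  have h5 : Real.exp (-(1 / (4 * τ)) * ‖x‖ ^ 2) =
      Real.exp (-(1 / (8 * τ)) * ‖x‖ ^ 2) * Real.exp (-(1 / (4 * (2 * τ))) * ‖x‖ ^ 2) := by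
    rw [← Real.exp_add]; congr 1; field_simp; ring
  rw [h4, h5]
  set c := (4 * Real.pi * τ) ^ (-(N : ℝ) / 2)
  set e1 := Real.exp (-(1 / (8 * τ)) * ‖x‖ ^ 2)
  set e2 := Real.exp (-(1 / (4 * (2 * τ))) * ‖x‖ ^ 2)
  have hc : 0 ≤ c := by positivity
  have he2 : 0 ≤ e2 := by positivity
  calc c * (e1 * e2) / (2 * τ) * ‖x‖ = (c * e2 / (2 * τ)) * (‖x‖ * e1) := by ring
    _ ≤ (c * e2 / (2 * τ)) * (4 * √τ) := by gcongr
    _ = _ := by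
      have : (2 : ℝ) ^ ((N : ℝ) / 2) ≠ 0 := by positivity
      have h6 : √τ / τ = 1 / √τ := by rw [div_eq_div_iff hτ.ne' hs.ne']; linarith
      calc _ = 2 * c * e2 * (√τ / τ) := by ring
        _ = _ := by rw [h6]; field_simp

theorem integrable_gradient_heatKernel {τ : ℝ} (hτ : 0 < τ) :
    Integrable (gradient (heatKernel (N := N) τ)) := by
  refine Integrable.mono' (((integrable_heatKernel (N := N)
    (show 0 < 2 * τ by positivity)).const_mul (2 * (1 / √τ))).const_mul (2 ^ ((N : ℝ) / 2)))
    (continuous_gradient_heatKernel τ).aestronglyMeasurable (ae_of_all _ fun x => ?_)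
  exact norm_gradient_heatKernel_le hτ x

theorem integral_norm_gradient_heatKernel_le {τ : ℝ} (hτ : 0 < τ) :
    ∫ x : Space N, ‖gradient (heatKernel τ) x‖ ≤ 2 ^ ((N : ℝ) / 2) * 2 * (1 / √τ) := by
  refine (integral_mono (integrable_gradient_heatKernel hτ).norm
    (((integrable_heatKernel (N := N) (show 0 < 2 * τ by positivity)).const_mul
      (2 * (1 / √τ))).const_mul (2 ^ ((N : ℝ) / 2)))
    (norm_gradient_heatKernel_le hτ)).trans_eq ?_
  rw [integral_const_mul, integral_const_mul, integral_heatKernel (by positivity)]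
  ring

theorem fourier_heatKernel {τ : ℝ} (hτ : 0 < τ) (ξ : Space N) :
    𝓕 (fun x : Space N => (heatKernel τ x : ℂ)) ξ
      = Complex.exp (-(4 * Real.pi ^ 2 * τ * ‖ξ‖ ^ 2 : ℝ)) := by
  have h := fourier_gaussian_innerProductSpace (V := Space N) (b := ((1 / (4 * τ) : ℝ) : ℂ))
    (by rw [Complex.ofReal_re]; positivity) ξ
  have h2 : (fun x : Space N => (heatKernel τ x : ℂ)) =
      (((4 * Real.pi * τ) ^ (-(N : ℝ) / 2) : ℝ) : ℂ) •
        fun x : Space N => Complex.exp (-((1 / (4 * τ) : ℝ) : ℂ) * ‖x‖ ^ 2) := by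
    funext x; rw [heatKernel_eq]; simp
  rw [h2, show ∀ (r : ℂ) (f : Space N → ℂ), 𝓕 (r • f) = r • 𝓕 f from
      fun r f => VectorFourier.fourierIntegral_const_smul _ _ _ f r, Pi.smul_apply, h, finrank_euclideanSpace_fin,
    smul_eq_mul, ← mul_assoc]
  have h3 : ((Real.pi : ℂ) / ((1 / (4 * τ) : ℝ) : ℂ)) ^ ((N : ℂ) / 2)
      = (((4 * Real.pi * τ) ^ ((N : ℝ) / 2) : ℝ) : ℂ) := by
    rw [Complex.ofReal_cpow (by positivity)]
    push_cast
    congr 1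
    have : (τ : ℂ) ≠ 0 := by exact_mod_cast hτ.ne'
    field_simp
  rw [h3, ← Complex.ofReal_mul, ← Real.rpow_add (by positivity)]
  have : -(N : ℝ) / 2 + N / 2 = 0 := by ring
  rw [this, Real.rpow_zero, Complex.ofReal_one, one_mul]
  congr 1
  have : (τ : ℂ) ≠ 0 := by exact_mod_cast hτ.ne'
  push_cast
  field_simp

theorem fourier_inner_gradient_heatKernel {τ : ℝ} (hτ : 0 < τ) (v ξ : Space N) :
    𝓕 (fun x : Space N => ((⟪gradient (heatKernel τ) x, v⟫ : ℝ) : ℂ)) ξ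
      = 2 * Real.pi * Complex.I * (⟪ξ, v⟫ : ℝ) *
        Complex.exp (-(4 * Real.pi ^ 2 * τ * ‖ξ‖ ^ 2 : ℝ)) := by
  have hd : ∀ x, HasFDerivAt (fun x : Space N => (heatKernel τ x : ℂ))
      (Complex.ofRealCLM ∘L (InnerProductSpace.toDual ℝ (Space N) (gradient (heatKernel τ) x))) x := by
    intro x
    have := (hasGradientAt_heatKernel (τ := τ) x)
    rw [← gradient_heatKernel, hasGradientAt_iff_hasFDerivAt] at this
    exact Complex.ofRealCLM.hasFDerivAt.comp x this
  have hfd : fderiv ℝ (fun x : Space N => (heatKernel τ x : ℂ)) = fun x =>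
      Complex.ofRealCLM ∘L (InnerProductSpace.toDual ℝ (Space N) (gradient (heatKernel τ) x)) :=
    funext fun x => (hd x).fderiv
  have hint : Integrable (fderiv ℝ (fun x : Space N => (heatKernel τ x : ℂ))) := by
    rw [hfd]
    refine (integrable_gradient_heatKernel (N := N) hτ).norm.mono' ?_ (ae_of_all _ fun x => ?_)
    · have := continuous_gradient_heatKernel (N := N) τ
      exact Continuous.aestronglyMeasurable (by fun_prop)
    · refine (ContinuousLinearMap.opNorm_comp_le _ _).trans ?_
      rw [(InnerProductSpace.toDual ℝ (Space N)).norm_map]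
      simp
  have h := Real.fourier_fderiv (integrable_heatKernel (N := N) hτ).ofReal
    (fun x => (hd x).differentiableAt) hint
  have h2 := Real.fourierIntegral_continuousLinearMap_apply' (L := innerSL ℝ) (a := v) (w := ξ) hint
  have h3 : 𝓕 (fderiv ℝ (fun x : Space N => (heatKernel τ x : ℂ))) ξ v =
      𝓕 (fun x => fderiv ℝ (fun x : Space N => (heatKernel τ x : ℂ)) x v) ξ := h2
  rw [h, hfd] at h3
  have h4 := fourier_heatKernel (N := N) hτ ξ
  simp only [VectorFourier.fourierSMulRight_apply] at h3
  change _ = 𝓕 (fun x : Space N => ((⟪gradient (heatKernel τ) x, v⟫ : ℝ) : ℂ)) ξ at h3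
  rw [← h3]
  have h5 : 𝓕 (fun x : Space N => ((heatKernel τ x : ℝ) : ℂ)) ξ = _ := h4
  rw [show (fun x : Space N => (heatKernel τ x : ℂ)) = fun x => ((heatKernel τ x : ℝ) : ℂ) from rfl,
    h5]
  simp [innerSL_apply_apply ℝ]
  ring

theorem integrable_fourierChar_smul_prod {α : Type*} [MeasurableSpace α] {ν : Measure α} [SFinite ν]
    {Φ : Space N × α → ℝ} (hΦ : Integrable Φ ((volume : Measure (Space N)).prod ν)) (ξ : Space N) :
    Integrable (fun z => (𝐞 (-⟪z.1, ξ⟫) : Circle) • (Φ z : ℂ))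
      ((volume : Measure (Space N)).prod ν) := by
  have hΦ' : Integrable (fun z => (Φ z : ℂ)) ((volume : Measure (Space N)).prod ν) := hΦ.ofReal
  refine hΦ'.norm.mono' ?_ (ae_of_all _ fun z => (Circle.norm_smul _ _).le)
  have h1 : Continuous fun x : Space N => ((𝐞 (-⟪x, ξ⟫) : Circle) : ℂ) := by fun_prop
  exact (h1.aestronglyMeasurable (μ := volume)).comp_fst.mul hΦ'.aestronglyMeasurable

/-- The Fourier transform of an integral over a parameter. -/
theorem fourier_integral_prod {α : Type*} [MeasurableSpace α] {ν : Measure α} [SFinite ν]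
    {Φ : Space N × α → ℝ} (hΦ : Integrable Φ ((volume : Measure (Space N)).prod ν)) (ξ : Space N) :
    𝓕 (fun x => ((∫ p, Φ (x, p) ∂ν : ℝ) : ℂ)) ξ = ∫ p, 𝓕 (fun x => (Φ (x, p) : ℂ)) ξ ∂ν := by
  simp_rw [Real.fourier_eq, ← integral_complex_ofReal, Circle.smul_def, ← integral_smul]
  exact integral_integral_swap (f := fun x p => ((𝐞 (-⟪x, ξ⟫) : Circle) : ℂ) • (Φ (x, p) : ℂ))
    (integrable_fourierChar_smul_prod hΦ ξ)

theorem fourier_comp_sub_right (f : Space N → ℂ) (y ξ : Space N) :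
    𝓕 (fun x => f (x - y)) ξ = (𝐞 (-⟪y, ξ⟫) : Circle) • 𝓕 f ξ := by
  have := congrFun (VectorFourier.fourierIntegral_comp_add_right (𝐞 : AddChar ℝ Circle)
    (volume : Measure (Space N)) (innerₗ (Space N)) f (-y)) ξ
  have h2 : (fun x => f (x - y)) = f ∘ fun v => v + -y := by
    funext x; simp [sub_eq_add_neg]
  rw [h2]
  refine this.trans ?_
  simp only [innerₗ_apply_apply, inner_neg_left]
  rfl

theorem fourier_sub_of_integrable {f g : Space N → ℂ} (hf : Integrable f) (hg : Integrable g)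
    (ξ : Space N) : 𝓕 (fun x => f x - g x) ξ = 𝓕 f ξ - 𝓕 g ξ := by
  simp_rw [Real.fourier_eq, smul_sub]
  exact integral_sub ((Real.fourierIntegral_convergent_iff ξ).2 hf)
    ((Real.fourierIntegral_convergent_iff ξ).2 hg)

theorem norm_fourier_le_integral_norm (f : Space N → ℂ) (ξ : Space N) :
    ‖𝓕 f ξ‖ ≤ ∫ x, ‖f x‖ :=
  VectorFourier.norm_fourierIntegral_le_integral_norm _ _ _ _ _

/-! ### Mild solutions on the Fourier side. -/

/-- Mild solutions of `u_t - ε Δu + ∇·F = 0` with an integrable flux `F`. -/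
structure IsMildSolution (ε : ℝ) (u₀ : Space N → ℝ) (u : ℝ → Space N → ℝ)
    (F : ℝ → Space N → Space N) : Prop where
  integrable_zero : Integrable u₀
  integrable : ∀ t, 0 ≤ t → Integrable (u t)
  flux_measurable : AEStronglyMeasurable (Function.uncurry F)
    ((volume.restrict (Ici (0 : ℝ))).prod volume)
  flux_integrable : ∀ t, 0 ≤ t → Integrable (F t)
  flux_continuous : ∀ t₀, 0 ≤ t₀ →
    Tendsto (fun t => ∫ x, ‖F t x - F t₀ x‖) (𝓝[Ici 0] t₀) (𝓝 0)
  duhamel : ∀ t, 0 < t → ∀ᵐ x,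
    u t x = (∫ y, heatKernel (ε * t) (x - y) * u₀ y)
      - ∫ s in (0 : ℝ)..t, ∫ y, ⟪gradient (heatKernel (ε * (t - s))) (x - y), F s y⟫

/-- A functional that is Lipschitz for the `L¹` distance is continuous along an `L¹`-continuous
curve. It serves for `L¹` norms, for `divHat` at a fixed frequency, and for pairings with bounded
functions. -/
theorem continuousOn_integral_of_continuous_L1 {E : Type*} [NormedAddCommGroup E]
    {v : ℝ → Space N → E} (hi : ∀ t, 0 ≤ t → Integrable (v t))
    (hc : ∀ t₀, 0 ≤ t₀ → Tendsto (fun t => ∫ x, ‖v t x - v t₀ x‖) (𝓝[Ici 0] t₀) (𝓝 0))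
    {G : Type*} [NormedAddCommGroup G] {Ψ : (Space N → E) → G} {C : ℝ}
    (hΨ : ∀ f g, Integrable f → Integrable g → ‖Ψ f - Ψ g‖ ≤ C * ∫ x, ‖f x - g x‖) :
    ContinuousOn (fun t => Ψ (v t)) (Ici 0) := by
  intro t₀ ht₀
  rw [ContinuousWithinAt, tendsto_iff_norm_sub_tendsto_zero]
  refine squeeze_zero' (Eventually.of_forall fun t => norm_nonneg _) ?_
    (by simpa using (hc t₀ ht₀).const_mul C)
  filter_upwards [self_mem_nhdsWithin] with t ht using hΨ _ _ (hi t ht) (hi t₀ ht₀)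

theorem abs_integral_norm_sub_le {E : Type*} [NormedAddCommGroup E] {f g : Space N → E}
    (hf : Integrable f) (hg : Integrable g) :
    ‖(∫ x, ‖f x‖) - ∫ x, ‖g x‖‖ ≤ 1 * ∫ x, ‖f x - g x‖ := by
  rw [one_mul, ← integral_sub hf.norm hg.norm]
  refine (norm_integral_le_integral_norm _).trans (integral_mono (hf.norm.sub hg.norm).norm
    (hf.sub hg).norm fun x => ?_)
  exact abs_norm_sub_norm_le _ _

/-- The Fourier transform of the divergence of a vector field. -/
def divHat (v : Space N → Space N) (ξ : Space N) : ℂ :=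
  2 * Real.pi * Complex.I * 𝓕 (fun x => ((⟪ξ, v x⟫ : ℝ) : ℂ)) ξ

theorem norm_divHat_sub_le {v w : Space N → Space N} (hv : Integrable v) (hw : Integrable w)
    (ξ : Space N) : ‖divHat v ξ - divHat w ξ‖ ≤ (2 * Real.pi * ‖ξ‖) * ∫ x, ‖v x - w x‖ := by
  unfold divHat
  have hv' : Integrable (fun x => ((⟪ξ, v x⟫ : ℝ) : ℂ)) := (hv.const_inner ξ).ofReal
  have hw' : Integrable (fun x => ((⟪ξ, w x⟫ : ℝ) : ℂ)) := (hw.const_inner ξ).ofReal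
  rw [← mul_sub, ← fourier_sub_of_integrable hv' hw', norm_mul]
  have h1 : ‖(2 * Real.pi * Complex.I : ℂ)‖ = 2 * Real.pi := by
    simp [abs_of_pos Real.pi_pos]
  rw [h1, mul_assoc (2 * Real.pi) ‖ξ‖]
  refine mul_le_mul_of_nonneg_left ?_ (show (0 : ℝ) ≤ 2 * Real.pi by positivity)
  refine (norm_fourier_le_integral_norm _ _).trans ?_
  rw [← integral_const_mul]
  refine integral_mono (hv'.sub hw').norm
    ((hv.sub hw).norm.const_mul _) fun x => ?_
  simp only
  rw [← Complex.ofReal_sub, Complex.norm_real, ← inner_sub_right]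
  exact norm_inner_le_norm _ _

theorem norm_divHat_le {v : Space N → Space N} (hv : Integrable v) (ξ : Space N) :
    ‖divHat v ξ‖ ≤ (2 * Real.pi * ‖ξ‖) * ∫ x, ‖v x‖ := by
  have h0 : Integrable (fun _ : Space N => (0 : Space N)) := integrable_const_iff.2 (Or.inl rfl)
  have h := norm_divHat_sub_le hv h0 ξ
  simpa [divHat, Real.fourier_eq] using h

theorem integrable_component {v : Space N → Space N} (hv : Integrable v) (i : Fin N) :
    Integrable (fun x => v x i) := by
  refine (hv.const_inner (𝕜 := ℝ) (EuclideanSpace.single i (1 : ℝ))).congr (ae_of_all _ fun x => ?_)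
  simp [EuclideanSpace.inner_single_left]

/-- In `divHat` the transformed function itself depends on `ξ`. The component form separates that
dependence, which gives measurability in `ξ` and lets each `ξ i` be moved onto a test function. -/
theorem divHat_eq_sum {v : Space N → Space N} (hv : Integrable v) (ξ : Space N) :
    divHat v ξ = ∑ i : Fin N,
      2 * Real.pi * Complex.I * ((ξ i : ℝ) : ℂ) * 𝓕 (fun x => ((v x i : ℝ) : ℂ)) ξ := by
  have h2 : ∀ i : Fin N, Integrable (fun x => ((v x i : ℝ) : ℂ)) := fun i =>
    (integrable_component hv i).ofReal
  simp only [divHat, Real.fourier_eq]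
  simp_rw [mul_assoc, ← Finset.mul_sum, ← integral_const_mul]
  rw [← integral_finsetSum _ fun i _ => ((Real.fourierIntegral_convergent_iff ξ).2
    (h2 i)).const_mul ((ξ i : ℝ) : ℂ)]
  simp_rw [← integral_const_mul]
  refine integral_congr_ae (ae_of_all _ fun x => ?_)
  simp only [PiLp.inner_apply, Circle.smul_def, smul_eq_mul, Complex.ofReal_sum, Finset.mul_sum]
  refine Finset.sum_congr rfl fun i _ => ?_
  simp
  ring

namespace IsMildSolution

variable {ε : ℝ} {u₀ : Space N → ℝ} {u : ℝ → Space N → ℝ} {F : ℝ → Space N → Space N}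

theorem exists_flux_bound (h : IsMildSolution ε u₀ u F) (T : ℝ) :
    ∃ B, ∀ s ∈ Icc 0 T, ∫ x, ‖F s x‖ ≤ B := by
  have hc : ContinuousOn (fun t => ∫ x, ‖F t x‖) (Ici 0) :=
    continuousOn_integral_of_continuous_L1 (Ψ := fun f => ∫ x, ‖f x‖) h.flux_integrable
      h.flux_continuous fun f g hf hg => abs_integral_norm_sub_le hf hg
  obtain ⟨B, hB⟩ := isCompact_Icc.exists_bound_of_continuousOn (hc.mono fun s (hs : s ∈ Icc 0 T) => hs.1)
  exact ⟨B, fun s hs => (le_abs_self _).trans (hB s hs)⟩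

theorem continuousOn_divHat (h : IsMildSolution ε u₀ u F) (ξ : Space N) :
    ContinuousOn (fun s => divHat (F s) ξ) (Ici 0) :=
  continuousOn_integral_of_continuous_L1 (Ψ := fun f => divHat f ξ) h.flux_integrable
    h.flux_continuous fun _ _ hf hg => norm_divHat_sub_le hf hg ξ

/-- The `L¹` norm of the kernel gradient is `O((ε(t-s))^{-1/2})`, integrable up to `s = t`, and the
flux is bounded in `L¹` on `[0, t]`. This licenses every use of Fubini in Duhamel's formula. -/
theorem integrable_duhamel (h : IsMildSolution ε u₀ u F) (hε : 0 < ε) (t : ℝ) :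
    Integrable (fun z : Space N × ℝ × Space N =>
      ⟪gradient (heatKernel (ε * (t - z.2.1))) (z.1 - z.2.2), F z.2.1 z.2.2⟫)
      (volume.prod ((volume.restrict (Ioc 0 t)).prod volume)) := by
  obtain ⟨B, hB⟩ := h.exists_flux_bound t
  have hFm : AEStronglyMeasurable (fun p : ℝ × Space N => F p.1 p.2)
      ((volume.restrict (Ioc 0 t)).prod volume) :=
    h.flux_measurable.mono_measure
      (Measure.prod_mono (Measure.restrict_mono (fun s hs => hs.1.le) le_rfl) le_rfl)
  have hGm : Measurable fun z : Space N × ℝ × Space N =>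
      gradient (heatKernel (ε * (t - z.2.1))) (z.1 - z.2.2) := by
    simp_rw [gradient_heatKernel, heatKernel]
    fun_prop
  -- The endpoint `s = t`, where the kernel has time zero, is discarded as a null set.
  have hs : ∀ᵐ s ∂(volume.restrict (Ioc 0 t)), s ∈ Ioo 0 t := by
    rw [← restrict_Ioo_eq_restrict_Ioc]; exact ae_restrict_mem measurableSet_Ioo
  have hp : ∀ᵐ p ∂((volume.restrict (Ioc 0 t)).prod (volume : Measure (Space N))), p.1 ∈ Ioo 0 t :=
    Measure.quasiMeasurePreserving_fst.ae hs
  have hm : AEStronglyMeasurable (fun z : Space N × ℝ × Space N =>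
      ⟪gradient (heatKernel (ε * (t - z.2.1))) (z.1 - z.2.2), F z.2.1 z.2.2⟫)
      (volume.prod ((volume.restrict (Ioc 0 t)).prod volume)) :=
    hGm.aestronglyMeasurable.inner hFm.comp_snd
  have hr : IntegrableOn (fun s => 1 / √(ε * (t - s))) (Ioc 0 t) := by
    have h1 : IntervalIntegrable (fun s : ℝ => s ^ (-(1 / 2) : ℝ)) volume (t - 0) (t - t) :=
      intervalIntegral.intervalIntegrable_rpow' (by norm_num)
    have h2 := (((h1.comp_sub_left t).const_mul (1 / √ε)).1).congr_fun_ae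
      (g := fun s => 1 / √(ε * (t - s))) ?_
    · simpa using h2
    · rw [sub_zero, sub_self, sub_zero]
      refine (ae_restrict_mem measurableSet_Ioc).mono fun s hs' => ?_
      simp only
      rw [Real.sqrt_mul hε.le, Real.rpow_neg (by linarith [hs'.2]), ← Real.sqrt_eq_rpow]
      field_simp
  have hbound : Integrable (fun p : ℝ × Space N => 1 / √(ε * (t - p.1)) * ‖F p.1 p.2‖)
      ((volume.restrict (Ioc 0 t)).prod volume) := by
    have hm' : AEStronglyMeasurable (fun p : ℝ × Space N => 1 / √(ε * (t - p.1)) * ‖F p.1 p.2‖)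
        ((volume.restrict (Ioc 0 t)).prod volume) := by
      refine AEStronglyMeasurable.mul ?_ hFm.norm
      exact Measurable.aestronglyMeasurable (by fun_prop)
    rw [integrable_prod_iff hm']
    refine ⟨hs.mono fun s hs => (h.flux_integrable s hs.1.le).norm.const_mul (1 / √(ε * (t - s))), ?_⟩
    refine (hr.mul_const B).mono' hm'.norm.integral_prod_right' (hs.mono fun s hs => ?_)
    rw [Real.norm_of_nonneg (integral_nonneg fun _ => norm_nonneg _)]
    simp only [norm_mul, norm_norm, integral_const_mul]
    rw [Real.norm_of_nonneg (by positivity)]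
    exact mul_le_mul_of_nonneg_left (hB s ⟨hs.1.le, hs.2.le⟩) (by positivity)
  rw [integrable_prod_iff' hm]
  constructor
  · refine hp.mono fun p hp => ?_
    exact ((integrable_gradient_heatKernel (mul_pos hε (sub_pos.2 hp.2))).comp_sub_right
      p.2).inner_const (𝕜 := ℝ) (F p.1 p.2)
  · refine (hbound.const_mul (2 ^ ((N : ℝ) / 2) * 2)).mono' hm.norm.prod_swap.integral_prod_right'
      (hp.mono fun p hp => ?_)
    have hτ := mul_pos hε (sub_pos.2 hp.2)
    have hi := (integrable_gradient_heatKernel (N := N) hτ).comp_sub_right p.2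
    rw [Real.norm_of_nonneg (integral_nonneg fun _ => norm_nonneg _)]
    calc ∫ x, ‖⟪gradient (heatKernel (ε * (t - p.1))) (x - p.2), F p.1 p.2⟫‖
        ≤ ∫ x, ‖gradient (heatKernel (ε * (t - p.1))) (x - p.2)‖ * ‖F p.1 p.2‖ :=
          integral_mono (hi.inner_const _).norm (hi.norm.mul_const _)
            fun x => norm_inner_le_norm _ _
      _ = (∫ x : Space N, ‖gradient (heatKernel (ε * (t - p.1))) x‖) * ‖F p.1 p.2‖ := by
          rw [integral_mul_const,
            integral_sub_right_eq_self (fun x => ‖gradient (heatKernel (ε * (t - p.1))) x‖)]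
      _ ≤ (2 ^ ((N : ℝ) / 2) * 2 * (1 / √(ε * (t - p.1)))) * ‖F p.1 p.2‖ :=
          mul_le_mul_of_nonneg_right (integral_norm_gradient_heatKernel_le hτ) (norm_nonneg _)
      _ = _ := by ring

/-- Convolutions become products, so Duhamel's formula becomes variation of constants for a scalar
ODE with decay rate `4π²ε|ξ|²`. -/
theorem fourier_eq (h : IsMildSolution ε u₀ u F) (hε : 0 < ε) {t : ℝ} (ht : 0 < t) (ξ : Space N) :
    𝓕 (fun x => (u t x : ℂ)) ξ =
      Complex.exp (-(4 * Real.pi ^ 2 * ε * ‖ξ‖ ^ 2 : ℝ) * t) * 𝓕 (fun x => (u₀ x : ℂ)) ξ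
        - ∫ s in (0 : ℝ)..t, Complex.exp (-(4 * Real.pi ^ 2 * ε * ‖ξ‖ ^ 2 : ℝ) * (t - s)) *
            divHat (F s) ξ := by
  have hΦ := h.integrable_duhamel hε t
  have hc : Integrable (fun z : Space N × Space N => heatKernel (ε * t) (z.1 - z.2) * u₀ z.2)
      (volume.prod volume) :=
    (h.integrable_zero.convolution_integrand (ContinuousLinearMap.mul ℝ ℝ).flip
      (integrable_heatKernel (mul_pos hε ht)))
  have hae : ∀ᵐ x, (u t x : ℂ) = ((∫ y, heatKernel (ε * t) (x - y) * u₀ y : ℝ) : ℂ)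
      - ((∫ p, ⟪gradient (heatKernel (ε * (t - p.1))) (x - p.2), F p.1 p.2⟫
          ∂((volume.restrict (Ioc 0 t)).prod volume) : ℝ) : ℂ) := by
    filter_upwards [h.duhamel t ht, hΦ.prod_right_ae] with x hx hx'
    rw [hx, integral_prod _ hx', intervalIntegral.integral_of_le ht.le]
    push_cast
    rfl
  have hc' : Integrable (fun x => ((∫ y, heatKernel (ε * t) (x - y) * u₀ y : ℝ) : ℂ)) :=
    hc.integral_prod_left.ofReal
  have hΦ' : Integrable (fun x => ((∫ p, ⟪gradient (heatKernel (ε * (t - p.1))) (x - p.2), F p.1 p.2⟫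
      ∂((volume.restrict (Ioc 0 t)).prod volume) : ℝ) : ℂ)) :=
    hΦ.integral_prod_left.ofReal
  rw [Real.fourier_congr_ae hae, fourier_sub_of_integrable hc' hΦ', fourier_integral_prod hc,
    fourier_integral_prod hΦ]
  congr 1
  · have h1 : ∀ y : Space N, 𝓕 (fun x : Space N => ((heatKernel (ε * t) (x - y) * u₀ y : ℝ) : ℂ)) ξ =
        Complex.exp (-(4 * Real.pi ^ 2 * ε * ‖ξ‖ ^ 2 : ℝ) * t) *
          ((𝐞 (-⟪y, ξ⟫) : Circle) • (u₀ y : ℂ)) := by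
      intro y
      have h2 := fourier_comp_sub_right
        (fun x => ((heatKernel (ε * t) x : ℝ) : ℂ) * (u₀ y : ℂ)) y ξ
      have h3 : 𝓕 (fun x : Space N => ((heatKernel (ε * t) x : ℝ) : ℂ) * (u₀ y : ℂ)) ξ =
          𝓕 (fun x : Space N => ((heatKernel (ε * t) x : ℝ) : ℂ)) ξ * (u₀ y : ℂ) := by
        simp_rw [Real.fourier_eq, ← integral_mul_const, smul_mul_assoc]
      rw [h3, fourier_heatKernel (mul_pos hε ht)] at h2
      push_cast at h2 ⊢
      rw [h2, Circle.smul_def, Circle.smul_def, smul_eq_mul, smul_eq_mul]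
      rw [show -(4 * (Real.pi : ℂ) ^ 2 * (ε * t) * (‖ξ‖ : ℂ) ^ 2) =
        -(4 * (Real.pi : ℂ) ^ 2 * ε * (‖ξ‖ : ℂ) ^ 2) * t by ring]
      ring
    simp_rw [h1, integral_const_mul, Real.fourier_eq]
  · have hs : ∀ᵐ s ∂(volume.restrict (Ioc 0 t)), s ∈ Ioo 0 t := by
      rw [← restrict_Ioo_eq_restrict_Ioc]; exact ae_restrict_mem measurableSet_Ioo
    have hint : Integrable (fun p : ℝ × Space N => 𝓕 (fun x : Space N =>
        ((⟪gradient (heatKernel (ε * (t - p.1))) (x - p.2), F p.1 p.2⟫ : ℝ) : ℂ)) ξ)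
        ((volume.restrict (Ioc 0 t)).prod volume) := by
      exact (integrable_fourierChar_smul_prod hΦ ξ).integral_prod_right
    rw [integral_prod _ hint, intervalIntegral.integral_of_le ht.le]
    refine integral_congr_ae (hs.mono fun s hs => ?_)
    have hτ := mul_pos hε (sub_pos.2 hs.2)
    simp only [divHat]
    rw [Real.fourier_eq (fun x => ((⟪ξ, F s x⟫ : ℝ) : ℂ)), ← mul_assoc, ← integral_const_mul]
    refine integral_congr_ae (ae_of_all _ fun y => ?_)
    have h2 := fourier_comp_sub_right
      (fun x => ((⟪gradient (heatKernel (ε * (t - s))) x, F s y⟫ : ℝ) : ℂ)) y ξ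
    rw [fourier_inner_gradient_heatKernel hτ] at h2
    refine h2.trans ?_
    simp only [Circle.smul_def, smul_eq_mul]
    push_cast
    rw [show -(4 * (Real.pi : ℂ) ^ 2 * (ε * (t - s)) * (‖ξ‖ : ℂ) ^ 2) =
        -(4 * (Real.pi : ℂ) ^ 2 * ε * (‖ξ‖ : ℂ) ^ 2) * (t - s) by ring]
    ring

theorem hasDerivAt_fourier (h : IsMildSolution ε u₀ u F) (hε : 0 < ε) {t : ℝ} (ht : 0 < t)
    (ξ : Space N) :
    HasDerivAt (fun t => 𝓕 (fun x => (u t x : ℂ)) ξ)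
      (-(4 * Real.pi ^ 2 * ε * ‖ξ‖ ^ 2 : ℝ) * 𝓕 (fun x => (u t x : ℂ)) ξ - divHat (F t) ξ) t := by
  set a : ℝ := 4 * Real.pi ^ 2 * ε * ‖ξ‖ ^ 2
  have hcont : ContinuousOn (fun s : ℝ => Complex.exp (a * s) * divHat (F s) ξ) (Ici 0) :=
    ContinuousOn.mul (by fun_prop) (h.continuousOn_divHat ξ)
  -- Factoring out `exp (-a t)` leaves an integrand independent of `t` and continuous in `s`, so the
  -- fundamental theorem of calculus applies.
  have heq : ∀ t : ℝ, 0 < t → 𝓕 (fun x => (u t x : ℂ)) ξ = Complex.exp (-a * t) *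
      (𝓕 (fun x => (u₀ x : ℂ)) ξ - ∫ s in (0 : ℝ)..t, Complex.exp (a * s) * divHat (F s) ξ) := by
    intro t ht
    rw [h.fourier_eq hε ht ξ, mul_sub, ← intervalIntegral.integral_const_mul]
    congr 1
    refine intervalIntegral.integral_congr fun s _ => ?_
    rw [← mul_assoc, ← Complex.exp_add]
    congr 2
    ring
  have h1 : HasDerivAt (fun t => ∫ s in (0 : ℝ)..t, Complex.exp (a * s) * divHat (F s) ξ)
      (Complex.exp (a * t) * divHat (F t) ξ) t := by
    refine intervalIntegral.integral_hasDerivAt_right ?_ ?_ ?_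
    · exact (hcont.mono (by rw [uIcc_of_le ht.le]; exact Icc_subset_Ici_self)).intervalIntegrable
    · exact ContinuousOn.stronglyMeasurableAtFilter isOpen_Ioi
        (hcont.mono Ioi_subset_Ici_self) t ht
    · exact hcont.continuousAt (Ici_mem_nhds ht)
  have h2 : HasDerivAt (fun t : ℝ => Complex.exp (-a * t)) (Complex.exp (-a * t) * (-a)) t := by
    have := ((hasDerivAt_id t).ofReal_comp.const_mul (-a : ℂ)).cexp
    simpa using this
  have h3 := h2.mul ((hasDerivAt_const t (𝓕 (fun x => (u₀ x : ℂ)) ξ)).sub h1)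
  refine (h3.congr_of_eventuallyEq ?_).congr_deriv ?_
  · filter_upwards [Ioi_mem_nhds ht] with s hs using heq s hs
  · rw [heq t ht]
    have h4 : Complex.exp (-a * t) * Complex.exp (a * t) = 1 := by
      rw [← Complex.exp_add]; simp
    simp only [Pi.sub_apply]
    linear_combination (-divHat (F t) ξ) * h4

/-- Frequency zero of the Fourier formula: the decay rate and the divergence both vanish there. -/
theorem integral_eq (h : IsMildSolution ε u₀ u F) (hε : 0 < ε) {t : ℝ} (ht : 0 < t) :
    ∫ x, u t x = ∫ x, u₀ x := by
  have h1 := h.fourier_eq hε ht 0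
  have h2 : ∀ v : Space N → Space N, divHat v 0 = 0 := fun v => by simp [divHat, Real.fourier_eq]
  simp only [h2, Real.fourier_eq] at h1
  simp only [inner_zero_right, neg_zero, AddChar.map_zero_eq_one, one_smul,
    integral_complex_ofReal] at h1
  simp at h1
  exact_mod_cast h1

end IsMildSolution

/-! ### Weak formulation against test functions. -/

theorem integral_fourier_mul_schwartz {f : Space N → ℂ} (hf : Integrable f) (ψ : 𝓢(Space N, ℂ)) :
    ∫ ξ, 𝓕 f ξ * ψ ξ = ∫ x, f x * 𝓕 ψ x := by
  simpa using! VectorFourier.integral_fourierIntegral_smul_eq_flip (L := innerₗ (Space N))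
    Real.continuous_fourierChar continuous_inner hf ψ.integrable

theorem continuous_fourier_of_integrable {f : Space N → ℂ} (hf : Integrable f) :
    Continuous (𝓕 f) :=
  VectorFourier.fourierIntegral_continuous Real.continuous_fourierChar
    (L := innerₗ (Space N)) continuous_inner hf

theorem smulLeftCLM_inner_apply (ψ : 𝓢(Space N, ℂ)) (v x : Space N) :
    SchwartzMap.smulLeftCLM ℂ (⟪·, v⟫ : Space N → ℝ) ψ x = (⟪x, v⟫ : ℝ) * ψ x := by
  have : (⟪·, v⟫ : Space N → ℝ).HasTemperateGrowth := by fun_prop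
  rw [SchwartzMap.smulLeftCLM_apply_apply this]
  simp

/-- A smooth, compactly supported test function together with its gradient and Laplacian. -/
structure IsTestFunction (χ : Space N → ℝ) (g : Fin N → Space N → ℝ) (l : Fin N → Space N → ℝ) :
    Prop where
  contDiff : ContDiff ℝ ∞ χ
  hasCompactSupport : HasCompactSupport χ
  hasLineDerivAt : ∀ i x, HasLineDerivAt ℝ χ (g i x) x (EuclideanSpace.single i 1)
  hasLineDerivAt₂ : ∀ i x, HasLineDerivAt ℝ (g i) (l i x) x (EuclideanSpace.single i 1)

theorem lineDerivOp_ofReal {θ : 𝓢(Space N, ℂ)} {χ g : Space N → ℝ} {v : Space N}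
    (hθ : ∀ x, θ x = χ x) (hg : ∀ x, HasLineDerivAt ℝ χ (g x) x v) (x : Space N) :
    (∂_{v} θ : 𝓢(Space N, ℂ)) x = (g x : ℂ) := by
  rw [SchwartzMap.lineDerivOp_apply]
  have h1 : (θ : Space N → ℂ) = fun x => (χ x : ℂ) := funext hθ
  rw [h1]
  exact (HasDerivAt.ofReal_comp (hg x)).deriv

namespace IsMildSolution

variable {ε : ℝ} {u₀ : Space N → ℝ} {u : ℝ → Space N → ℝ} {F : ℝ → Space N → Space N}

/-- Differentiation under the integral sign: the frequency derivative grows at most like `|ξ|²`,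
uniformly for times in `(0, 2t)`, and the decay of `ψ` absorbs this growth. -/
theorem hasDerivAt_integral_fourier_mul (h : IsMildSolution ε u₀ u F) (hε : 0 < ε) {t : ℝ}
    (ht : 0 < t) (ψ : 𝓢(Space N, ℂ)) {M : ℝ} (hM : ∀ t, 0 ≤ t → ∫ x, ‖u t x‖ ≤ M) :
    HasDerivAt (fun t => ∫ ξ, 𝓕 (fun x => (u t x : ℂ)) ξ * ψ ξ)
      (∫ ξ, (-(4 * Real.pi ^ 2 * ε * ‖ξ‖ ^ 2 : ℝ) * 𝓕 (fun x => (u t x : ℂ)) ξ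
        - divHat (F t) ξ) * ψ ξ) t := by
  obtain ⟨B, hB⟩ := h.exists_flux_bound (2 * t)
  have huc : ∀ t, 0 ≤ t → Continuous (𝓕 (fun x => (u t x : ℂ))) := fun t ht =>
    continuous_fourier_of_integrable (h.integrable t ht).ofReal
  have hdm : AEStronglyMeasurable (divHat (F t)) := by
    have h1 := funext (divHat_eq_sum (h.flux_integrable t ht.le))
    rw [h1]
    refine Finset.aestronglyMeasurable_fun_sum _ fun i _ => ?_
    refine AEStronglyMeasurable.mul (Continuous.aestronglyMeasurable (by fun_prop)) ?_
    exact (continuous_fourier_of_integrable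
      (integrable_component (h.flux_integrable t ht.le) i).ofReal).aestronglyMeasurable
  have hub : ∀ t, 0 ≤ t → ∀ ξ, ‖𝓕 (fun x => (u t x : ℂ)) ξ‖ ≤ M := fun t ht ξ => by
    refine (norm_fourier_le_integral_norm _ _).trans (le_trans (le_of_eq ?_) (hM t ht))
    simp
  refine And.right <| hasDerivAt_integral_of_dominated_loc_of_deriv_le (𝕜 := ℝ)
    (F := fun t ξ => 𝓕 (fun x => (u t x : ℂ)) ξ * ψ ξ)
    (F' := fun t ξ => (-(4 * Real.pi ^ 2 * ε * ‖ξ‖ ^ 2 : ℝ) * 𝓕 (fun x => (u t x : ℂ)) ξ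
        - divHat (F t) ξ) * ψ ξ)
    (bound := fun ξ => 4 * Real.pi ^ 2 * ε * M * (‖ξ‖ ^ 2 * ‖ψ ξ‖)
      + 2 * Real.pi * B * (‖ξ‖ ^ 1 * ‖ψ ξ‖))
    (Ioo_mem_nhds ht (show t < 2 * t by linarith)) ?_ ?_ ?_ ?_ ?_ ?_
  · filter_upwards [Ioi_mem_nhds ht] with s hs
    exact ((huc s (le_of_lt hs)).mul ψ.continuous).aestronglyMeasurable
  · refine (ψ.integrable.norm.const_mul M).mono' ((huc t ht.le).mul ψ.continuous).aestronglyMeasurable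
      (ae_of_all _ fun ξ => ?_)
    rw [norm_mul]
    exact mul_le_mul_of_nonneg_right (hub t ht.le ξ) (norm_nonneg _)
  · refine AEStronglyMeasurable.mul (AEStronglyMeasurable.sub ?_ hdm)
      ψ.continuous.aestronglyMeasurable
    have := huc t ht.le
    exact Continuous.aestronglyMeasurable (by fun_prop)
  · refine ae_of_all _ fun ξ s hs => ?_
    have h1 := hub s hs.1.le ξ
    have h2 : ‖divHat (F s) ξ‖ ≤ 2 * Real.pi * ‖ξ‖ * B :=
      (norm_divHat_le (h.flux_integrable s hs.1.le) ξ).trans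
        (mul_le_mul_of_nonneg_left (hB s ⟨hs.1.le, hs.2.le⟩) (by positivity))
    rw [norm_mul]
    calc _ ≤ (4 * Real.pi ^ 2 * ε * ‖ξ‖ ^ 2 * M + 2 * Real.pi * ‖ξ‖ * B) * ‖ψ ξ‖ := by
          refine mul_le_mul_of_nonneg_right ((norm_sub_le _ _).trans (add_le_add ?_ h2))
            (norm_nonneg _)
          rw [norm_mul, norm_neg, Complex.norm_real, Real.norm_of_nonneg (by positivity)]
          exact mul_le_mul_of_nonneg_left h1 (by positivity)
      _ = _ := by ring
  · exact ((ψ.integrable_pow_mul volume 2).const_mul _).add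
      ((ψ.integrable_pow_mul volume 1).const_mul _)
  · exact ae_of_all _ fun ξ s hs => (h.hasDerivAt_fourier hε hs.1 ξ).mul_const _

/-- Choose `ψ` with Fourier transform `χ`. Multiplying `ψ` by `-2πi ξ_i` amounts to differentiating
`χ` in direction `i`, so the multipliers in the ODE become derivatives of the test function, and no
regularity of `u` in space is needed. -/
theorem hasDerivAt_integral_mul (h : IsMildSolution ε u₀ u F) (hε : 0 < ε) {t : ℝ}
    (ht : 0 < t) {M : ℝ} (hM : ∀ t, 0 ≤ t → ∫ x, ‖u t x‖ ≤ M) {χ : Space N → ℝ}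
    {g l : Fin N → Space N → ℝ} (hχ : IsTestFunction χ g l) :
    HasDerivAt (fun t => ∫ x, u t x * χ x)
      (∑ i, (ε * ∫ x, u t x * l i x) + ∑ i, ∫ x, F t x i * g i x) t := by
  have hχs : HasCompactSupport (fun x => (χ x : ℂ)) :=
    hχ.hasCompactSupport.comp_left (g := ((↑) : ℝ → ℂ)) Complex.ofReal_zero
  let θ : 𝓢(Space N, ℂ) := hχs.toSchwartzMap (Complex.ofRealCLM.contDiff.comp hχ.contDiff)
  have hθ : ∀ x, θ x = χ x := fun x => rfl
  obtain ⟨ψ, hψ⟩ : ∃ ψ : 𝓢(Space N, ℂ), 𝓕 ψ = θ := ⟨𝓕⁻ θ, FourierTransform.fourier_fourierInv_eq θ⟩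
  let c : ℂ := -(2 * Real.pi * Complex.I)
  let D : Fin N → 𝓢(Space N, ℂ) → 𝓢(Space N, ℂ) := fun i η =>
    c • SchwartzMap.smulLeftCLM ℂ (⟪·, EuclideanSpace.single i 1⟫ : Space N → ℝ) η
  have hD : ∀ i η (x : Space N), D i η x = c * (x i * η x) := fun i η x => by
    simp only [D, smul_apply, smulLeftCLM_inner_apply]
    simp [EuclideanSpace.inner_single_right]
  have hFD : ∀ i η, 𝓕 (D i η) = ∂_{(EuclideanSpace.single i 1 : Space N)} (𝓕 η) := fun i η =>
    (SchwartzMap.lineDerivOp_fourier_eq η _).symm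
  have hg : ∀ i x, 𝓕 (D i ψ) x = g i x := fun i x => by
    rw [hFD, hψ]; exact lineDerivOp_ofReal hθ (hχ.hasLineDerivAt i) x
  have hl : ∀ i x, 𝓕 (D i (D i ψ)) x = l i x := fun i x => by
    rw [hFD]; exact lineDerivOp_ofReal (hg i) (hχ.hasLineDerivAt₂ i) x
  have huI : ∀ s, 0 ≤ s → Integrable (fun x => (u s x : ℂ)) := fun s hs => (h.integrable s hs).ofReal
  have hFI : ∀ i, Integrable (fun x => (F t x i : ℂ)) := fun i =>
    (integrable_component (h.flux_integrable t ht.le) i).ofReal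
  have hpair : ∀ s, 0 ≤ s → ∫ ξ, 𝓕 (fun x => (u s x : ℂ)) ξ * ψ ξ = ((∫ x, u s x * χ x : ℝ) : ℂ) := by
    intro s hs
    rw [integral_fourier_mul_schwartz (huI s hs), hψ, ← integral_complex_ofReal]
    simp [hθ]
  have hdiv : ∀ ξ, divHat (F t) ξ = ∑ i : Fin N, -(c * ξ i) * 𝓕 (fun x => (F t x i : ℂ)) ξ := by
    intro ξ
    rw [divHat_eq_sum (h.flux_integrable t ht.le)]
    refine Finset.sum_congr rfl fun i _ => ?_
    simp only [c]; ring
  have hder := h.hasDerivAt_integral_fourier_mul hε ht ψ hM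
  have hbd : ∀ {f : Space N → ℂ}, Integrable f → ∀ η : 𝓢(Space N, ℂ),
      Integrable (fun ξ => 𝓕 f ξ * η ξ) := fun {f} hf η => by
    refine (η.integrable.norm.const_mul (∫ x, ‖f x‖)).mono'
      ((continuous_fourier_of_integrable hf).mul η.continuous).aestronglyMeasurable
      (ae_of_all _ fun ξ => ?_)
    rw [norm_mul]
    exact mul_le_mul_of_nonneg_right (norm_fourier_le_integral_norm _ _) (norm_nonneg _)
  have hval : ∫ ξ, (-(4 * Real.pi ^ 2 * ε * ‖ξ‖ ^ 2 : ℝ) * 𝓕 (fun x => (u t x : ℂ)) ξ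
        - divHat (F t) ξ) * ψ ξ
      = ((∑ i, (ε * ∫ x, u t x * l i x) + ∑ i, ∫ x, F t x i * g i x : ℝ) : ℂ) := by
    have h1 : ∀ ξ, (-(4 * Real.pi ^ 2 * ε * ‖ξ‖ ^ 2 : ℝ) * 𝓕 (fun x => (u t x : ℂ)) ξ
        - divHat (F t) ξ) * ψ ξ = ∑ i, (ε * (𝓕 (fun x => (u t x : ℂ)) ξ * D i (D i ψ) ξ))
          + ∑ i, 𝓕 (fun x => (F t x i : ℂ)) ξ * D i ψ ξ := by
      intro ξ
      have hc : c * c = -(4 * Real.pi ^ 2) := by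
        simp only [c]; linear_combination (4 * (Real.pi : ℂ) ^ 2) * Complex.I_sq
      have hn : ((‖ξ‖ ^ 2 : ℝ) : ℂ) = ∑ i, (ξ i : ℂ) * ξ i := by
        rw [EuclideanSpace.real_norm_sq_eq]; push_cast
        exact Finset.sum_congr rfl fun i _ => sq _
      rw [hdiv, sub_mul, sub_eq_add_neg, Finset.sum_mul, ← Finset.sum_neg_distrib]
      congr 1
      · rw [Complex.ofReal_mul, hn, Finset.mul_sum, ← Finset.sum_neg_distrib, Finset.sum_mul,
          Finset.sum_mul]
        refine Finset.sum_congr rfl fun i _ => ?_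
        rw [hD, hD]
        push_cast
        linear_combination (-(ε : ℂ) * (ξ i * ξ i) * 𝓕 (fun x => (u t x : ℂ)) ξ * ψ ξ) * hc
      · refine Finset.sum_congr rfl fun i _ => ?_
        rw [hD]; ring
    simp_rw [h1]
    rw [integral_add, integral_finsetSum, integral_finsetSum]
    · push_cast
      congr 1
      · refine Finset.sum_congr rfl fun i _ => ?_
        rw [integral_const_mul, integral_fourier_mul_schwartz (huI t ht.le),
          ← integral_complex_ofReal]
        simp [hl]
      · refine Finset.sum_congr rfl fun i _ => ?_
        rw [integral_fourier_mul_schwartz (hFI i), ← integral_complex_ofReal]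
        simp [hg]
    · exact fun i _ => hbd (hFI i) _
    · exact fun i _ => (hbd (huI t ht.le) _).const_mul _
    · exact integrable_finsetSum _ fun i _ => (hbd (huI t ht.le) _).const_mul _
    · exact integrable_finsetSum _ fun i _ => hbd (hFI i) _
  rw [hval] at hder
  have hder' : HasDerivAt (fun s => ((∫ x, u s x * χ x : ℝ) : ℂ))
      ((∑ i, (ε * ∫ x, u t x * l i x) + ∑ i, ∫ x, F t x i * g i x : ℝ) : ℂ) t := by
    refine hder.congr_of_eventuallyEq ?_
    filter_upwards [Ioi_mem_nhds ht] with s hs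
    exact (hpair s (le_of_lt hs)).symm
  exact Complex.reCLM.hasFDerivAt.comp_hasDerivAt t hder'

end IsMildSolution

/-! ### Drift velocity and flux estimates in `L¹`. -/

/-- The gradient of the radial function with profile `k`. -/
def radialField (k : ℝ → ℝ) (z : Space N) : Space N := (deriv k ‖z‖ / ‖z‖) • z

theorem measurable_radialField (k : ℝ → ℝ) : Measurable (radialField (N := N) k) := by
  have h : Measurable (deriv k) := measurable_deriv k
  unfold radialField
  exact ((h.comp measurable_norm).div measurable_norm).smul measurable_id

/-- The essential bound holds everywhere because `k'` is continuous: the set where it fails is open,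
hence of positive measure if nonempty. -/
theorem IsRadialKernel.abs_deriv_le (hK : IsRadialKernel K k) {s : ℝ} (hs : 0 < s) :
    |deriv k s| ≤ supNormDeriv k := by
  have hc : ContinuousOn (deriv k) (Ioi 0) :=
    hK.contDiffOn.continuousOn_deriv_of_isOpen isOpen_Ioi le_rfl
  have hae : ∀ᵐ s ∂(volume.restrict (Ioi (0 : ℝ))), |deriv k s| ≤ supNormDeriv k := by
    have h1 := hK.deriv_memLp
    have h2 := ae_le_eLpNormEssSup (f := deriv k) (μ := volume.restrict (Ioi (0 : ℝ)))
    filter_upwards [h2] with s hs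
    have h3 : eLpNorm (deriv k) ⊤ (volume.restrict (Ioi (0 : ℝ))) ≠ ⊤ := h1.2.ne
    rw [← eLpNorm_exponent_top] at hs
    have := ENNReal.toReal_mono h3 hs
    simpa [supNormDeriv] using this
  by_contra! hlt
  have hopen : IsOpen (Ioi (0 : ℝ) ∩ (fun s => |deriv k s|) ⁻¹' Ioi (supNormDeriv k)) :=
    hc.abs.isOpen_inter_preimage isOpen_Ioi isOpen_Ioi
  have hpos := hopen.measure_pos volume ⟨s, hs, hlt⟩
  rw [ae_restrict_iff' measurableSet_Ioi] at hae
  refine hpos.ne' (measure_mono_null ?_ hae)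
  intro x hx hx'
  exact absurd (hx' hx.1) (not_le.2 hx.2)

theorem IsRadialKernel.gradient_eq (hK : IsRadialKernel K k) {z : Space N} (hz : z ≠ 0) :
    gradient K z = radialField k z := by
  have hz' : 0 < ‖z‖ := norm_pos_iff.2 hz
  have hk : HasDerivAt k (deriv k ‖z‖) ‖z‖ :=
    ((hK.contDiffOn.contDiffAt (Ioi_mem_nhds hz')).differentiableAt (by norm_num)).hasDerivAt
  have h1 : HasFDerivAt (fun x : Space N => √(‖x‖ ^ 2)) ((1 / (2 * √(‖z‖ ^ 2))) • (2 • innerSL ℝ z)) z :=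
    (hasStrictFDerivAt_norm_sq z).hasFDerivAt.sqrt (by positivity)
  have h2 : HasFDerivAt (fun x : Space N => ‖x‖) ((1 / (2 * √(‖z‖ ^ 2))) • (2 • innerSL ℝ z)) z := by
    simpa [Real.sqrt_sq (norm_nonneg _)] using h1
  have h3 := hk.comp_hasFDerivAt z h2
  have h4 : HasGradientAt K (radialField k z) z := by
    rw [hasGradientAt_iff_hasFDerivAt]
    refine (h3.congr_of_eventuallyEq ?_).congr_fderiv ?_
    · filter_upwards [isOpen_ne.mem_nhds hz] with x hx using hK.eq_profile x hx
    · ext v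
      rw [Real.sqrt_sq hz'.le]
      simp [radialField, innerSL_apply_apply ℝ]
      field_simp
  exact h4.gradient

theorem supNormDeriv_nonneg (k : ℝ → ℝ) : 0 ≤ supNormDeriv k := ENNReal.toReal_nonneg

theorem norm_radialField_le {L : ℝ} (hL0 : 0 ≤ L) (hL : ∀ s, 0 < s → |deriv k s| ≤ L) (z : Space N) :
    ‖radialField k z‖ ≤ L := by
  by_cases hz : z = 0
  · simpa [radialField, hz] using hL0
  have hz' : 0 < ‖z‖ := norm_pos_iff.2 hz
  rw [radialField, norm_smul, norm_div, norm_norm, div_mul_cancel₀ _ hz'.ne']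
  exact hL _ hz'

theorem integrable_smul_radialField {L : ℝ} (hL0 : 0 ≤ L) (hL : ∀ s, 0 < s → |deriv k s| ≤ L)
    {v : Space N → ℝ} (hv : Integrable v) (x : Space N) :
    Integrable (fun y => v y • radialField k (x - y)) := by
  refine (hv.norm.mul_const L).mono' (hv.aestronglyMeasurable.smul
    ((measurable_radialField k).comp (measurable_const.sub measurable_id)).aestronglyMeasurable)
    (ae_of_all _ fun y => ?_)
  rw [norm_smul]
  exact mul_le_mul_of_nonneg_left (norm_radialField_le hL0 hL _) (norm_nonneg _)

/-- The unknown value of `∇K` at the origin matters only at `y = x`, a null set because `N ≥ 1`. -/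
theorem IsRadialKernel.drift_eq (hN : 1 ≤ N) (hK : IsRadialKernel K k) (v : Space N → ℝ) (x : Space N) :
    drift K v x = ∫ y, v y • radialField k (x - y) := by
  have : NeZero N := ⟨by omega⟩
  have : Nontrivial (Space N) := inferInstance
  refine integral_congr_ae ?_
  have : ∀ᵐ y : Space N, y ≠ x := by
    simp [ae_iff]
  filter_upwards [this] with y hy
  rw [hK.gradient_eq (sub_ne_zero.2 hy.symm)]

theorem IsRadialKernel.norm_drift_le (hN : 1 ≤ N) (hK : IsRadialKernel K k) {v : Space N → ℝ}
    (hv : Integrable v) (x : Space N) : ‖drift K v x‖ ≤ supNormDeriv k * ∫ y, ‖v y‖ := by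
  rw [hK.drift_eq hN, mul_comm, ← integral_mul_const]
  refine norm_integral_le_of_norm_le (hv.norm.mul_const _) (ae_of_all _ fun y => ?_)
  rw [norm_smul]
  exact mul_le_mul_of_nonneg_left
    (norm_radialField_le (supNormDeriv_nonneg k) (fun s hs => hK.abs_deriv_le hs) _) (norm_nonneg _)

theorem IsRadialKernel.drift_sub (hN : 1 ≤ N) (hK : IsRadialKernel K k) {v w : Space N → ℝ}
    (hv : Integrable v) (hw : Integrable w) (x : Space N) :
    drift K v x - drift K w x = drift K (fun y => v y - w y) x := by
  simp_rw [hK.drift_eq hN, sub_smul]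
  have hL : ∀ s, 0 < s → |deriv k s| ≤ supNormDeriv k := fun s hs => hK.abs_deriv_le hs
  rw [integral_sub (integrable_smul_radialField (supNormDeriv_nonneg k) hL hv x)
    (integrable_smul_radialField (supNormDeriv_nonneg k) hL hw x)]

theorem IsRadialKernel.aestronglyMeasurable_drift (hN : 1 ≤ N) (hK : IsRadialKernel K k)
    {α : Type*} [MeasurableSpace α] {μ : Measure α} [SFinite μ] {v : α → Space N → ℝ}
    (hv : AEStronglyMeasurable (Function.uncurry v) (μ.prod volume)) :
    AEStronglyMeasurable (fun p : α × Space N => drift K (v p.1) p.2) (μ.prod volume) := by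
  simp_rw [hK.drift_eq hN]
  have hq : Measure.QuasiMeasurePreserving
      (fun q : (α × Space N) × Space N => (q.1.1, q.2)) ((μ.prod volume).prod volume)
      (μ.prod volume) :=
    QuasiMeasurePreserving.prodMap Measure.quasiMeasurePreserving_fst
      (Measure.QuasiMeasurePreserving.id _)
  refine AEStronglyMeasurable.integral_prod_right'
    (f := fun q : (α × Space N) × Space N => v q.1.1 q.2 • radialField k (q.1.2 - q.2)) ?_
  refine AEStronglyMeasurable.smul (hv.comp_quasiMeasurePreserving hq) ?_
  exact ((measurable_radialField k).comp (by fun_prop)).aestronglyMeasurable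

theorem IsRadialKernel.aestronglyMeasurable_drift_of_integrable (hN : 1 ≤ N) (hK : IsRadialKernel K k)
    {v : Space N → ℝ} (hv : Integrable v) : AEStronglyMeasurable (drift K v) volume := by
  -- The parametrised statement is used with a one-point parameter space.
  have h := hK.aestronglyMeasurable_drift hN (μ := Measure.dirac ()) (v := fun _ => v)
    hv.aestronglyMeasurable.comp_snd
  have h2 := h.prodMk_left
  simpa using h2

theorem IsRadialKernel.integrable_flux (hN : 1 ≤ N) (hK : IsRadialKernel K k)
    {v w : Space N → ℝ} (hv : Integrable v) (hw : Integrable w) :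
    Integrable (fun x => v x • drift K w x) := by
  refine (hv.norm.mul_const (supNormDeriv k * ∫ y, ‖w y‖)).mono' (hv.aestronglyMeasurable.smul
    (hK.aestronglyMeasurable_drift_of_integrable hN hw)) (ae_of_all _ fun x => ?_)
  rw [norm_smul]
  exact mul_le_mul_of_nonneg_left (hK.norm_drift_le hN hw x) (norm_nonneg _)

theorem IsRadialKernel.integral_norm_flux_le (hN : 1 ≤ N) (hK : IsRadialKernel K k)
    {v w : Space N → ℝ} (hv : Integrable v) (hw : Integrable w) :
    ∫ x, ‖v x • drift K w x‖ ≤ supNormDeriv k * (∫ x, ‖v x‖) * ∫ x, ‖w x‖ := by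
  calc _ ≤ ∫ x, ‖v x‖ * (supNormDeriv k * ∫ y, ‖w y‖) := by
        refine integral_mono (hK.integrable_flux hN hv hw).norm (hv.norm.mul_const _) fun x => ?_
        simp only
        rw [norm_smul]
        exact mul_le_mul_of_nonneg_left (hK.norm_drift_le hN hw x) (norm_nonneg _)
    _ = _ := by rw [integral_mul_const]; ring

/-- The flux is quadratic. With `d = v - w` and `b` the drift, `v b(v) - w b(w) = d b(d) + d b(w) +
w b(d)`. Hence `L¹` continuity of `u` passes to its flux. -/
theorem IsRadialKernel.integral_norm_flux_sub_le (hN : 1 ≤ N) (hK : IsRadialKernel K k)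
    {v w : Space N → ℝ} (hv : Integrable v) (hw : Integrable w) :
    ∫ x, ‖v x • drift K v x - w x • drift K w x‖ ≤
      supNormDeriv k * ((∫ x, ‖v x - w x‖) * (∫ x, ‖v x - w x‖)
        + 2 * (∫ x, ‖w x‖) * ∫ x, ‖v x - w x‖) := by
  have hd : Integrable (fun x => v x - w x) := hv.sub hw
  have h1 := hK.integrable_flux hN hd hd
  have h2 := hK.integrable_flux hN hd hw
  have h3 := hK.integrable_flux hN hw hd
  have heq : ∀ x, v x • drift K v x - w x • drift K w x =
      (v x - w x) • drift K (fun y => v y - w y) x + (v x - w x) • drift K w x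
        + w x • drift K (fun y => v y - w y) x := by
    intro x
    rw [← hK.drift_sub hN hv hw]
    module
  calc _ ≤ ∫ x, (‖(v x - w x) • drift K (fun y => v y - w y) x‖ + ‖(v x - w x) • drift K w x‖
        + ‖w x • drift K (fun y => v y - w y) x‖) := by
        refine integral_mono_of_nonneg (ae_of_all _ fun _ => norm_nonneg _)
          ((h1.norm.add h2.norm).add h3.norm) (ae_of_all _ fun x => ?_)
        simp only
        rw [heq]
        exact norm_add₃_le
    _ ≤ _ := by
        have h12 : Integrable (fun x => ‖(v x - w x) • drift K (fun y => v y - w y) x‖ +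
            ‖(v x - w x) • drift K w x‖) := h1.norm.add h2.norm
        rw [integral_add h12 h3.norm, integral_add h1.norm h2.norm]
        have e1 := hK.integral_norm_flux_le hN hd hd
        have e2 := hK.integral_norm_flux_le hN hd hw
        have e3 := hK.integral_norm_flux_le hN hw hd
        linarith

theorem IsSolution.isMildSolution (hN : 1 ≤ N) (hK : IsRadialKernel K k) {ε : ℝ} {u₀ : Space N → ℝ}
    {u : ℝ → Space N → ℝ} (hu₀ : Integrable u₀) (hu : IsSolution ε K u₀ u) :
    IsMildSolution ε u₀ u (fun s x => u s x • drift K (u s) x) where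
  integrable_zero := hu₀
  integrable := hu.integrable
  flux_measurable := hu.aestronglyMeasurable.smul
    (hK.aestronglyMeasurable_drift hN hu.aestronglyMeasurable)
  flux_integrable t ht := hK.integrable_flux hN (hu.integrable t ht) (hu.integrable t ht)
  flux_continuous t₀ ht₀ := by
    have h0 := hu.continuous_L1 t₀ ht₀
    have h1 : Tendsto (fun t => supNormDeriv k * ((∫ x, |u t x - u t₀ x|) * (∫ x, |u t x - u t₀ x|)
        + 2 * (∫ x, ‖u t₀ x‖) * ∫ x, |u t x - u t₀ x|)) (𝓝[Ici 0] t₀) (𝓝 0) := by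
      simpa using ((h0.mul h0).add (h0.const_mul (2 * ∫ x, ‖u t₀ x‖))).const_mul (supNormDeriv k)
    refine squeeze_zero' (Eventually.of_forall fun t => integral_nonneg fun _ => norm_nonneg _) ?_ h1
    filter_upwards [self_mem_nhdsWithin] with t ht
    exact hK.integral_norm_flux_sub_le hN (hu.integrable t ht) (hu.integrable t₀ ht₀)
  duhamel := hu.duhamel

theorem radialField_neg (k : ℝ → ℝ) (z : Space N) : radialField k (-z) = -radialField k z := by
  simp [radialField]

/-! ### Attraction between points of an annulus. -/

/-- The direction `x/|x|`. -/
def direction (x : Space N) : Space N := ‖x‖⁻¹ • x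

theorem direction_neg (x : Space N) : direction (-x) = -direction x := by
  simp [direction]

theorem norm_direction_le (x : Space N) : ‖direction x‖ ≤ 1 := by
  rw [direction, norm_smul, norm_inv, norm_norm]
  exact inv_mul_le_one

/-- The identity `(e_x - e_y)·(x - y) = (|x| + |y|)(1 - e_x·e_y)` and `|x| + |y| ≥ |x - y|` cancel
the denominator of the field; `|x - y| < Λ` makes `k' ≤ -κ` available. -/
theorem inner_direction_radialField_le {κ Λ : ℝ} (hκ : 0 ≤ κ)
    (hk : ∀ s ∈ Ioo 0 Λ, deriv k s ≤ -κ) {x y : Space N} (hx0 : x ≠ 0) (hy0 : y ≠ 0)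
    (hx : ‖x‖ < Λ / 2) (hy : ‖y‖ < Λ / 2) :
    ⟪direction x - direction y, radialField k (x - y)⟫
      ≤ -κ * (1 - ⟪direction x, direction y⟫) := by
  have hx' : 0 < ‖x‖ := norm_pos_iff.2 hx0
  have hy' : 0 < ‖y‖ := norm_pos_iff.2 hy0
  have hc : ⟪direction x, direction y⟫ ≤ 1 :=
    (real_inner_le_norm _ _).trans
      (mul_le_one₀ (norm_direction_le x) (norm_nonneg _) (norm_direction_le y))
  by_cases hxy : x = y
  · subst hxy
    have : ⟪direction x, direction x⟫ = 1 := by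
      rw [real_inner_self_eq_norm_sq, direction, norm_smul, norm_inv, norm_norm,
        inv_mul_cancel₀ hx'.ne', one_pow]
    simp only [this, sub_self, inner_zero_left, mul_zero, le_refl]
  · have hd : 0 < ‖x - y‖ := norm_pos_iff.2 (sub_ne_zero.2 hxy)
    have hS : ‖x - y‖ ≤ ‖x‖ + ‖y‖ := norm_sub_le x y
    have hin : ⟪direction x - direction y, x - y⟫
        = (‖x‖ + ‖y‖) * (1 - ⟪direction x, direction y⟫) := by
      simp only [direction, inner_sub_left, inner_sub_right, real_inner_smul_left,
        real_inner_smul_right, real_inner_self_eq_norm_sq, real_inner_comm x y]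
      field_simp
      ring
    have hkd := hk ‖x - y‖ ⟨hd, by linarith⟩
    rw [radialField, real_inner_smul_right, hin]
    have h1 : deriv k ‖x - y‖ / ‖x - y‖ * (‖x‖ + ‖y‖) ≤ -κ := by
      rw [div_mul_eq_mul_div, div_le_iff₀ hd]
      nlinarith [norm_nonneg (x - y)]
    calc _ = (deriv k ‖x - y‖ / ‖x - y‖ * (‖x‖ + ‖y‖)) * (1 - ⟪direction x, direction y⟫) := by ring
      _ ≤ _ := mul_le_mul_of_nonneg_right h1 (by linarith)

/-- On `A × A` the directions interact attractively, and replacing them by `G` costs at most `2ηL`;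
elsewhere the crude bound `2L` is used. Indicators merge both cases into one inequality whose last
term factorises in `x` and `y`. -/
theorem interaction_pointwise {κ Λ L η r : ℝ} (hκ : 0 ≤ κ) (hr : 0 < r) (hη : 0 ≤ η) (hL0 : 0 ≤ L)
    (hk : ∀ s ∈ Ioo 0 Λ, deriv k s ≤ -κ) (hL : ∀ s, 0 < s → |deriv k s| ≤ L)
    {G : Space N → Space N} (hG1 : ∀ x, ‖G x‖ ≤ 1)
    {A : Set (Space N)} (hA : A = {x | r ≤ ‖x‖ ∧ ‖x‖ < Λ / 2})
    (hGη : ∀ x ∈ A, ‖G x - direction x‖ ≤ η) (x y : Space N) :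
    ⟪G x, radialField k (x - y)⟫ + ⟪G y, radialField k (y - x)⟫ ≤
      2 * L + (-κ + 2 * η * L - 2 * L) * (A.indicator 1 x * A.indicator 1 y)
        + κ * ⟪A.indicator (1 : Space N → ℝ) x • direction x,
            A.indicator (1 : Space N → ℝ) y • direction y⟫ := by
  have hF : ‖radialField k (x - y)‖ ≤ L := norm_radialField_le hL0 hL _
  by_cases hxy : x ∈ A ∧ y ∈ A
  · obtain ⟨hx, hy⟩ := hxy
    have e1 := hGη x hx
    have e2 := hGη y hy
    have hx2 : r ≤ ‖x‖ ∧ ‖x‖ < Λ / 2 := by rw [hA] at hx; exact hx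
    have hy2 : r ≤ ‖y‖ ∧ ‖y‖ < Λ / 2 := by rw [hA] at hy; exact hy
    have h1 := inner_direction_radialField_le hκ hk (norm_pos_iff.1 (hr.trans_le hx2.1))
      (norm_pos_iff.1 (hr.trans_le hy2.1)) hx2.2 hy2.2
    have h2 : ⟪(G x - direction x) - (G y - direction y), radialField k (x - y)⟫ ≤ 2 * η * L := by
      refine (real_inner_le_norm _ _).trans ?_
      refine mul_le_mul ((norm_sub_le _ _).trans (by linarith)) hF (norm_nonneg _) (by linarith)
    have h3 : ⟪G x, radialField k (x - y)⟫ + ⟪G y, radialField k (y - x)⟫ =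
        ⟪(G x - direction x) - (G y - direction y), radialField k (x - y)⟫ +
        ⟪direction x - direction y, radialField k (x - y)⟫ := by
      rw [← neg_sub x y, radialField_neg]
      simp only [inner_sub_left, inner_neg_right]
      ring
    simp only [indicator_of_mem hx, indicator_of_mem hy, Pi.one_apply, one_smul]
    rw [h3]
    linarith
  · have h0 : A.indicator (1 : Space N → ℝ) x = 0 ∨ A.indicator (1 : Space N → ℝ) y = 0 := by
      by_contra! hne
      exact hxy ⟨by_contra fun hx => hne.1 (indicator_of_notMem hx _),
        by_contra fun hy => hne.2 (indicator_of_notMem hy _)⟩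
    have hzero : A.indicator (1 : Space N → ℝ) x * A.indicator (1 : Space N → ℝ) y = 0 :=
      mul_eq_zero.2 h0
    have hzero' : ⟪A.indicator (1 : Space N → ℝ) x • direction x,
        A.indicator (1 : Space N → ℝ) y • direction y⟫ = 0 := by
      rw [real_inner_smul_left, real_inner_smul_right, ← mul_assoc, hzero, zero_mul]
    rw [hzero, hzero', mul_zero, mul_zero, add_zero, add_zero]
    have hb : ∀ z w : Space N, ⟪G z, radialField k w⟫ ≤ L := fun z w =>
      (real_inner_le_norm _ _).trans
        ((mul_le_mul (hG1 z) (norm_radialField_le hL0 hL w) (norm_nonneg _) zero_le_one).trans_eq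
          (one_mul L))
    linarith [hb x (x - y), hb y (y - x)]

/-- The integrand is odd. This is where radial symmetry of the solution enters, and only through
evenness. -/
theorem integral_indicator_smul_direction {v : Space N → ℝ} (heven : ∀ᵐ x, v (-x) = v x)
    {A : Set (Space N)} (hA : ∀ x, -x ∈ A ↔ x ∈ A) :
    ∫ x, v x • A.indicator (1 : Space N → ℝ) x • direction x = 0 := by
  have h1 : ∫ x, v x • A.indicator (1 : Space N → ℝ) x • direction x =
      ∫ x, -(v x • A.indicator (1 : Space N → ℝ) x • direction x) := by
    rw [← integral_neg_eq_self]
    refine integral_congr_ae (heven.mono fun x hx => ?_)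
    have : A.indicator (1 : Space N → ℝ) (-x) = A.indicator (1 : Space N → ℝ) x := by
      by_cases hx : x ∈ A
      · rw [indicator_of_mem hx, indicator_of_mem ((hA x).2 hx)]; rfl
      · rw [indicator_of_notMem hx, indicator_of_notMem (mt (hA x).1 hx)]
    simp only [this, hx, direction_neg, smul_neg]
  rw [integral_neg] at h1
  have h2 : (2 : ℝ) • ∫ x, v x • A.indicator (1 : Space N → ℝ) x • direction x = 0 := by
    rw [two_smul]; nth_rewrite 1 [h1]; exact neg_add_cancel _
  exact (smul_eq_zero.1 h2).resolve_left two_ne_zero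

/-- The double integral equals its copy with `x` and `y` exchanged, so the pointwise bound on the
sum controls twice the drift term. The factorised term integrates to the squared norm of a vanishing
vector. -/
theorem integral_inner_drift_le (hN : 1 ≤ N) (hK : IsRadialKernel K k)
    {κ Λ η r : ℝ} (hκ : 0 ≤ κ) (hr : 0 < r) (hη : 0 ≤ η)
    (hk : ∀ s ∈ Ioo 0 Λ, deriv k s ≤ -κ)
    {G : Space N → Space N} (hGm : Measurable G) (hG1 : ∀ x, ‖G x‖ ≤ 1)
    {A : Set (Space N)} (hA : A = {x | r ≤ ‖x‖ ∧ ‖x‖ < Λ / 2})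
    (hGη : ∀ x ∈ A, ‖G x - direction x‖ ≤ η)
    {v : Space N → ℝ} (hv : Integrable v) (hv0 : 0 ≤ᵐ[volume] v) (heven : ∀ᵐ x, v (-x) = v x) :
    ∫ x, ⟪G x, v x • drift K v x⟫ ≤ (∫ x, v x) * (-(κ * (∫ x, v x) / 2)
      + (κ + 2 * supNormDeriv k) * ((∫ x, v x) - ∫ x in A, v x)
      + η * supNormDeriv k * ∫ x, v x) := by
  have hL : ∀ s, 0 < s → |deriv k s| ≤ supNormDeriv k := fun s hs => hK.abs_deriv_le hs
  have hL0 : 0 ≤ supNormDeriv k := supNormDeriv_nonneg k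
  set L := supNormDeriv k
  set M := ∫ x, v x
  set a : Space N → ℝ := A.indicator 1
  set MA := ∫ x in A, v x
  have hAm : MeasurableSet A := by
    rw [hA]
    exact (measurableSet_le measurable_const measurable_norm).inter
      (measurableSet_lt measurable_norm measurable_const)
  have ham : Measurable a := measurable_one.indicator hAm
  have hdm : Measurable (direction (N := N)) := by unfold direction; fun_prop
  have hva : ∀ x, v x * a x = A.indicator v x := fun x => by
    by_cases hx : x ∈ A <;> simp [a, hx]
  have hvaI : Integrable (fun x => v x * a x) := by
    simp_rw [hva]; exact hv.indicator hAm
  have hMA : ∫ x, v x * a x = MA := by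
    simp_rw [hva]; exact integral_indicator hAm
  have hMA0 : 0 ≤ MA := setIntegral_nonneg_of_ae hv0
  have hMAM : MA ≤ M := setIntegral_le_integral hv hv0
  have hvv : Integrable (fun p : Space N × Space N => v p.1 * v p.2) (volume.prod volume) :=
    hv.mul_prod hv
  have hJm : Measurable (fun p : Space N × Space N => ⟪G p.1, radialField k (p.1 - p.2)⟫) :=
    (hGm.comp measurable_fst).inner
      ((measurable_radialField k).comp (measurable_fst.sub measurable_snd))
  have hJb : ∀ p : Space N × Space N, ‖⟪G p.1, radialField k (p.1 - p.2)⟫‖ ≤ L := fun p =>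
    (norm_inner_le_norm _ _).trans ((mul_le_mul (hG1 _) (norm_radialField_le hL0 hL _)
      (norm_nonneg _) zero_le_one).trans_eq (one_mul L))
  have hI : Integrable (fun p : Space N × Space N =>
      v p.1 * v p.2 * ⟪G p.1, radialField k (p.1 - p.2)⟫) (volume.prod volume) :=
    hvv.mul_bdd (c := L) hJm.aestronglyMeasurable (ae_of_all _ hJb)
  have hI' : Integrable (fun p : Space N × Space N =>
      v p.1 * v p.2 * ⟪G p.2, radialField k (p.2 - p.1)⟫) (volume.prod volume) := by
    refine hI.swap.congr (ae_of_all _ fun p => ?_)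
    simp [mul_comm]
  have hfst : ∫ x, ⟪G x, v x • drift K v x⟫ = ∫ p : Space N × Space N,
      v p.1 * v p.2 * ⟪G p.1, radialField k (p.1 - p.2)⟫ ∂(volume.prod volume) := by
    rw [integral_prod _ hI]
    refine integral_congr_ae (ae_of_all _ fun x => ?_)
    simp only
    rw [hK.drift_eq hN, real_inner_smul_right,
      ← integral_inner (integrable_smul_radialField hL0 hL hv x), ← integral_const_mul]
    refine integral_congr_ae (ae_of_all _ fun y => ?_)
    simp only [real_inner_smul_right]
    ring
  have hsnd : ∫ p : Space N × Space N,
      v p.1 * v p.2 * ⟪G p.2, radialField k (p.2 - p.1)⟫ ∂(volume.prod volume) =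
      ∫ p : Space N × Space N,
      v p.1 * v p.2 * ⟪G p.1, radialField k (p.1 - p.2)⟫ ∂(volume.prod volume) := by
    rw [← integral_prod_swap]
    refine integral_congr_ae (ae_of_all _ fun p => ?_)
    simp [mul_comm]
  have hm : Integrable (fun x => v x • a x • direction x) := by
    have h1 : Integrable (fun x => (v x * a x) • direction x) := by
      refine hvaI.norm.mono' (hvaI.aestronglyMeasurable.smul hdm.aestronglyMeasurable)
        (ae_of_all _ fun x => ?_)
      rw [norm_smul]
      exact mul_le_of_le_one_right (norm_nonneg _) (norm_direction_le x)
    refine h1.congr (ae_of_all _ fun x => (smul_smul _ _ _).symm)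
  have hE : Integrable (fun p : Space N × Space N =>
      ⟪v p.1 • a p.1 • direction p.1, v p.2 • a p.2 • direction p.2⟫) (volume.prod volume) := by
    refine (hm.norm.mul_prod hm.norm).mono' ?_ (ae_of_all _ fun p => norm_inner_le_norm _ _)
    exact hm.aestronglyMeasurable.comp_fst.inner hm.aestronglyMeasurable.comp_snd
  have hE0 : ∫ p : Space N × Space N,
      ⟪v p.1 • a p.1 • direction p.1, v p.2 • a p.2 • direction p.2⟫ ∂(volume.prod volume) = 0 := by
    rw [integral_prod _ hE]
    have h0 : ∫ x, v x • a x • direction x = 0 :=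
      integral_indicator_smul_direction heven fun x => by rw [hA]; simp
    simp_rw [integral_inner hm, h0, inner_zero_right, integral_zero]
  have haa : Integrable (fun p : Space N × Space N => (v p.1 * a p.1) * (v p.2 * a p.2))
      (volume.prod volume) := hvaI.mul_prod hvaI
  have hpt : ∀ᵐ p ∂((volume : Measure (Space N)).prod (volume : Measure (Space N))),
      v p.1 * v p.2 * ⟪G p.1, radialField k (p.1 - p.2)⟫ +
      v p.1 * v p.2 * ⟪G p.2, radialField k (p.2 - p.1)⟫ ≤
      2 * L * (v p.1 * v p.2)
        + (-κ + 2 * η * L - 2 * L) * ((v p.1 * a p.1) * (v p.2 * a p.2))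
        + κ * ⟪v p.1 • a p.1 • direction p.1, v p.2 • a p.2 • direction p.2⟫ := by
    filter_upwards [Measure.quasiMeasurePreserving_fst.ae hv0,
      Measure.quasiMeasurePreserving_snd.ae hv0] with p h1 h2
    have h3 := mul_le_mul_of_nonneg_left
      (interaction_pointwise hκ hr hη hL0 hk hL hG1 hA hGη p.1 p.2) (mul_nonneg h1 h2)
    rw [mul_add] at h3
    refine h3.trans_eq ?_
    simp only [real_inner_smul_left, real_inner_smul_right, a]
    ring
  have hmono := integral_mono_ae (hI.add hI') (((hvv.const_mul (2 * L)).add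
    (haa.const_mul (-κ + 2 * η * L - 2 * L))).add (hE.const_mul κ)) hpt
  simp only [Pi.add_apply] at hmono
  have hsum : ∫ p : Space N × Space N, 2 * L * (v p.1 * v p.2)
        + (-κ + 2 * η * L - 2 * L) * ((v p.1 * a p.1) * (v p.2 * a p.2))
        + κ * ⟪v p.1 • a p.1 • direction p.1, v p.2 • a p.2 • direction p.2⟫ ∂(volume.prod volume)
      = 2 * L * (M * M) + (-κ + 2 * η * L - 2 * L) * (MA * MA) := by
    have hab : Integrable (fun p : Space N × Space N => 2 * L * (v p.1 * v p.2)
        + (-κ + 2 * η * L - 2 * L) * ((v p.1 * a p.1) * (v p.2 * a p.2))) (volume.prod volume) :=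
      (hvv.const_mul _).add (haa.const_mul _)
    rw [integral_add hab (hE.const_mul κ), integral_add (hvv.const_mul _) (haa.const_mul _),
      integral_const_mul, integral_const_mul, integral_const_mul, hE0, integral_prod_mul,
      integral_prod_mul (fun x => v x * a x) (fun x => v x * a x), hMA]
    ring
  rw [integral_add hI hI', hsnd, ← hfst, hsum] at hmono
  -- Linearises the squared annulus mass in the deficit `M - MA`.
  have hMM : M * M - 2 * M * (M - MA) ≤ MA * MA := by nlinarith [sq_nonneg (M - MA)]
  have hη2 : η * L * (MA * MA) ≤ η * L * (M * M) :=
    mul_le_mul_of_nonneg_left (mul_self_le_mul_self hMA0 hMAM) (mul_nonneg hη hL0)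
  have hκL := mul_le_mul_of_nonneg_left hMM (show 0 ≤ κ + 2 * L by linarith)
  linarith

/-! ### Construction of the smoothed truncated norm. -/

/-- Supplies continuity and boundedness of the second derivatives, and thus integrability of their
products with `u`. -/
theorem IsTestFunction.exists_schwartz {χ : Space N → ℝ} {g l : Fin N → Space N → ℝ}
    (hχ : IsTestFunction χ g l) (i : Fin N) : ∃ θ : 𝓢(Space N, ℂ), ∀ x, θ x = l i x := by
  have hχs : HasCompactSupport (fun x => (χ x : ℂ)) :=
    hχ.hasCompactSupport.comp_left (g := ((↑) : ℝ → ℂ)) Complex.ofReal_zero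
  let θ : 𝓢(Space N, ℂ) := hχs.toSchwartzMap (Complex.ofRealCLM.contDiff.comp hχ.contDiff)
  have hθ : ∀ x, θ x = χ x := fun x => rfl
  exact ⟨_, lineDerivOp_ofReal (lineDerivOp_ofReal hθ (hχ.hasLineDerivAt i)) (hχ.hasLineDerivAt₂ i)⟩

theorem IsTestFunction.integrable_mul {χ : Space N → ℝ} {g l : Fin N → Space N → ℝ}
    (hχ : IsTestFunction χ g l) (i : Fin N) {v : Space N → ℝ} (hv : Integrable v) :
    Integrable (fun x => v x * l i x) := by
  obtain ⟨θ, hθ⟩ := hχ.exists_schwartz i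
  obtain ⟨C, hC⟩ := θ.decay 0 0
  have hl : l i = fun x => (θ x).re := funext fun x => by rw [hθ]; rfl
  refine hv.mul_bdd (c := C) ?_ (ae_of_all _ fun x => ?_)
  · rw [hl]; exact (Complex.continuous_re.comp θ.continuous).aestronglyMeasurable
  · have := hC.2 x
    rw [pow_zero, one_mul, norm_iteratedFDeriv_zero, hθ, Complex.norm_real] at this
    exact this

/-- A smooth cutoff equal to `1` on `(-∞, 3Λ/4]` and to `0` on `[Λ, ∞)`. -/
def cutoff (Λ r : ℝ) : ℝ := Real.smoothTransition ((Λ - r) / (Λ / 4))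

theorem contDiff_cutoff (Λ : ℝ) : ContDiff ℝ ∞ (cutoff Λ) :=
  Real.smoothTransition.contDiff.comp (by fun_prop)

theorem cutoff_nonneg (Λ r : ℝ) : 0 ≤ cutoff Λ r := Real.smoothTransition.nonneg _

theorem cutoff_le_one (Λ r : ℝ) : cutoff Λ r ≤ 1 := Real.smoothTransition.le_one _

theorem cutoff_eq_one {Λ r : ℝ} (hΛ : 0 < Λ) (hr : r ≤ 3 * Λ / 4) : cutoff Λ r = 1 := by
  refine Real.smoothTransition.one_of_one_le ?_
  rw [le_div_iff₀ (by positivity)]; linarith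

theorem cutoff_eq_zero {Λ r : ℝ} (hΛ : 0 < Λ) (hr : Λ ≤ r) : cutoff Λ r = 0 :=
  Real.smoothTransition.zero_of_nonpos (div_nonpos_of_nonpos_of_nonneg (by linarith) (by positivity))

theorem antitone_cutoff {Λ : ℝ} (hΛ : 0 < Λ) : Antitone (cutoff Λ) := by
  intro r s hrs
  refine Real.smoothTransition.monotone ?_
  gcongr

theorem deriv_cutoff_nonpos {Λ : ℝ} (hΛ : 0 < Λ) (r : ℝ) : deriv (cutoff Λ) r ≤ 0 :=
  (antitone_cutoff hΛ).deriv_nonpos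

/-- The primitive of the cutoff: a smooth version of `min r Λ`. -/
def truncation (Λ r : ℝ) : ℝ := ∫ s in (0 : ℝ)..r, cutoff Λ s

theorem hasDerivAt_truncation (Λ r : ℝ) : HasDerivAt (truncation Λ) (cutoff Λ r) r :=
  (contDiff_cutoff Λ).continuous.integral_hasStrictDerivAt 0 r |>.hasDerivAt

theorem contDiff_truncation (Λ : ℝ) : ContDiff ℝ ∞ (truncation Λ) := by
  rw [contDiff_infty_iff_deriv]
  refine ⟨fun r => (hasDerivAt_truncation Λ r).differentiableAt, ?_⟩
  have : deriv (truncation Λ) = cutoff Λ := funext fun r => (hasDerivAt_truncation Λ r).deriv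
  rw [this]
  exact contDiff_cutoff Λ

theorem truncation_sub (Λ r s : ℝ) : truncation Λ s - truncation Λ r = ∫ x in r..s, cutoff Λ x :=
  intervalIntegral.integral_interval_sub_left
    ((contDiff_cutoff Λ).continuous.intervalIntegrable _ _)
    ((contDiff_cutoff Λ).continuous.intervalIntegrable _ _)

theorem monotone_truncation (Λ : ℝ) : Monotone (truncation Λ) :=
  monotone_of_deriv_nonneg (fun r => (hasDerivAt_truncation Λ r).differentiableAt)
    fun r => by rw [(hasDerivAt_truncation Λ r).deriv]; exact cutoff_nonneg Λ r

theorem truncation_sub_le {Λ r s : ℝ} (hrs : r ≤ s) : truncation Λ s - truncation Λ r ≤ s - r := by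
  rw [truncation_sub]
  have := intervalIntegral.integral_mono_on hrs
    ((contDiff_cutoff Λ).continuous.intervalIntegrable r s)
    (intervalIntegrable_const (μ := volume) (c := (1 : ℝ))) fun x _ => cutoff_le_one Λ x
  simpa using this

theorem truncation_zero (Λ : ℝ) : truncation Λ 0 = 0 := intervalIntegral.integral_same

theorem truncation_eq_of_le {Λ r : ℝ} (hΛ : 0 < Λ) (hr : Λ ≤ r) :
    truncation Λ r = truncation Λ Λ := by
  have h := truncation_sub Λ Λ r
  rw [intervalIntegral.integral_congr (g := fun _ => (0 : ℝ)) fun x hx => ?_] at h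
  · simp at h; linarith
  · rw [uIcc_of_le hr] at hx; exact cutoff_eq_zero hΛ hx.1

theorem truncation_half {Λ : ℝ} (hΛ : 0 < Λ) : truncation Λ (Λ / 2) = Λ / 2 := by
  rw [truncation, intervalIntegral.integral_congr (g := fun _ => (1 : ℝ)) fun x hx => ?_]
  · simp
  · rw [uIcc_of_le (by positivity)] at hx; exact cutoff_eq_one hΛ (by linarith [hx.2])

theorem truncation_le_min {Λ r : ℝ} (hΛ : 0 < Λ) (hr : 0 ≤ r) : truncation Λ r ≤ min r Λ := by
  have h1 : ∀ s, 0 ≤ s → truncation Λ s ≤ s := fun s hs => by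
    simpa [truncation_zero] using truncation_sub_le (Λ := Λ) hs
  refine le_min (h1 r hr) ?_
  rcases le_total r Λ with h | h
  · exact (h1 r hr).trans h
  · rw [truncation_eq_of_le hΛ h]; exact h1 Λ hΛ.le

/-- The regularised norm `√(|x|² + δ²)`. -/
def regNorm (δ : ℝ) (x : Space N) : ℝ := √(‖x‖ ^ 2 + δ ^ 2)

theorem regNorm_sq (δ : ℝ) (x : Space N) : regNorm δ x ^ 2 = ‖x‖ ^ 2 + δ ^ 2 :=
  Real.sq_sqrt (by positivity)

theorem norm_le_regNorm (δ : ℝ) (x : Space N) : ‖x‖ ≤ regNorm δ x :=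
  Real.le_sqrt_of_sq_le (by nlinarith [sq_nonneg δ])

theorem le_regNorm (δ : ℝ) (x : Space N) : δ ≤ regNorm δ x :=
  Real.le_sqrt_of_sq_le (by nlinarith [sq_nonneg ‖x‖])

theorem regNorm_le {δ : ℝ} (hδ : 0 ≤ δ) (x : Space N) : regNorm δ x ≤ ‖x‖ + δ := by
  rw [regNorm, Real.sqrt_le_left (by positivity)]
  nlinarith [mul_nonneg (norm_nonneg x) hδ]

theorem contDiff_regNorm {δ : ℝ} (hδ : 0 < δ) : ContDiff ℝ ∞ (regNorm (N := N) δ) :=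
  ((contDiff_norm_sq ℝ).add contDiff_const).sqrt fun x => by positivity

theorem hasFDerivAt_regNorm {δ : ℝ} (hδ : 0 < δ) (x : Space N) :
    HasFDerivAt (regNorm δ) ((regNorm δ x)⁻¹ • innerSL ℝ x) x := by
  have h := (((hasStrictFDerivAt_norm_sq x).hasFDerivAt.add_const (δ ^ 2)).sqrt
    (by positivity : ‖x‖ ^ 2 + δ ^ 2 ≠ 0))
  refine h.congr_fderiv ?_
  ext v
  change 1 / (2 * regNorm δ x) * (2 • ⟪x, v⟫) = (regNorm δ x)⁻¹ * ⟪x, v⟫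
  rw [nsmul_eq_mul]
  push_cast
  ring

theorem hasLineDerivAt_comp_regNorm {δ : ℝ} (hδ : 0 < δ) {f : ℝ → ℝ} {f' : ℝ} {x : Space N}
    (hf : HasDerivAt f f' (regNorm δ x)) (i : Fin N) :
    HasLineDerivAt ℝ (fun x => f (regNorm δ x)) (f' * (x i / regNorm δ x)) x
      (EuclideanSpace.single i 1) := by
  have h := (hf.comp_hasFDerivAt x (hasFDerivAt_regNorm hδ x)).hasLineDerivAt
    (EuclideanSpace.single i 1)
  convert! h using 1
  simp [innerSL_apply_apply ℝ, EuclideanSpace.inner_single_right]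
  left
  ring

/-- A smoothed truncated norm: the test function `φ`, with gradient `G` and second derivatives `l`. -/
structure IsTruncatedNorm (Λ δ c : ℝ) (φ : Space N → ℝ) (G : Space N → Space N)
    (l : Fin N → Space N → ℝ) : Prop where
  isTestFunction : IsTestFunction (fun x => c - φ x) (fun i x => -(G x i)) (fun i x => -(l i x))
  measurable_gradient : Measurable G
  norm_gradient_le : ∀ x, ‖G x‖ ≤ 1
  gradient_sub_direction : ∀ x, x ≠ 0 → ‖x‖ < Λ / 2 → ‖G x - direction x‖ ≤ δ / ‖x‖
  laplacian_le : ∀ x, ∑ i, l i x ≤ N / δ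
  continuous : Continuous φ
  nonneg : ∀ x, 0 ≤ φ x
  le_min_add : ∀ x, φ x ≤ min ‖x‖ Λ + δ
  le_of_le : ∀ x, Λ / 2 ≤ ‖x‖ → Λ / 2 ≤ φ x

/-- Take the primitive of the cutoff at `√(|x|² + δ²)`. Its gradient is `q(ρ) x`, where `ρ` is the
regularised norm and `q(s) = cutoff Λ s / s` is nonincreasing for `s > 0`. The term with `q'` in
each pure second derivative is then nonpositive, and `q(ρ) ≤ 1/δ` bounds the other one. Outside the
ball of radius `Λ` the function equals the constant `c`. -/
theorem exists_isTruncatedNorm {Λ δ : ℝ} (hΛ : 0 < Λ) (hδ : 0 < δ) (hδΛ : δ ≤ Λ / 2) :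
    ∃ (c : ℝ) (φ : Space N → ℝ) (G : Space N → Space N) (l : Fin N → Space N → ℝ),
      IsTruncatedNorm Λ δ c φ G l := by
  have hρ : ∀ x : Space N, 0 < regNorm δ x := fun x => hδ.trans_le (le_regNorm δ x)
  have hρc : Continuous (regNorm (N := N) δ) := (contDiff_regNorm hδ).continuous
  let q : ℝ → ℝ := fun s => cutoff Λ s / s
  let q' : ℝ → ℝ := fun s => (deriv (cutoff Λ) s * s - cutoff Λ s) / s ^ 2
  have hq : ∀ s, 0 < s → HasDerivAt q (q' s) s := fun s hs => by
    have := (((contDiff_cutoff Λ).differentiable (by simp)) s).hasDerivAt.div (hasDerivAt_id s) hs.ne'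
    exact this.congr_deriv (by simp [q'])
  have hq' : ∀ s, 0 < s → q' s ≤ 0 := fun s hs =>
    div_nonpos_of_nonpos_of_nonneg (by nlinarith [deriv_cutoff_nonpos hΛ s, cutoff_nonneg Λ s])
      (by positivity)
  refine ⟨truncation Λ Λ, fun x => truncation Λ (regNorm δ x), fun x => q (regNorm δ x) • x,
    fun i x => q' (regNorm δ x) * (x i / regNorm δ x) * x i + q (regNorm δ x), ?_, ?_, ?_, ?_, ?_, ?_,
    ?_, ?_, ?_⟩
  · refine ⟨contDiff_const.sub ((contDiff_truncation Λ).comp (contDiff_regNorm hδ)), ?_, ?_, ?_⟩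
    · refine HasCompactSupport.of_support_subset_isCompact
        (isCompact_closedBall (0 : Space N) Λ) fun x hx => ?_
      by_contra hx'
      rw [mem_closedBall_zero_iff, not_le] at hx'
      exact hx (sub_eq_zero.2 (truncation_eq_of_le hΛ (hx'.le.trans (norm_le_regNorm δ x))).symm)
    · intro i x
      have h := (hasLineDerivAt_comp_regNorm hδ (hasDerivAt_truncation Λ (regNorm δ x)) i)
      refine (HasDerivAt.const_sub (truncation Λ Λ) h).congr_deriv ?_
      simp [q]; ring
    · intro i x
      have h := (hasLineDerivAt_comp_regNorm hδ (hq _ (hρ x)) i)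
      have hx : HasLineDerivAt ℝ (fun x : Space N => x i) 1 x (EuclideanSpace.single i 1) := by
        have h1 : HasFDerivAt (fun x : Space N => x i) (EuclideanSpace.proj i : Space N →L[ℝ] ℝ) x :=
          (EuclideanSpace.proj i : Space N →L[ℝ] ℝ).hasFDerivAt
        simpa using h1.hasLineDerivAt (EuclideanSpace.single i 1)
      have h2 := (HasDerivAt.mul h hx).neg
      refine (h2.congr_deriv ?_)
      simp
  · have hcm : Measurable (cutoff Λ) := (contDiff_cutoff Λ).continuous.measurable
    have hρm := hρc.measurable
    exact ((hcm.comp hρm).div hρm).smul measurable_id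
  · intro x
    rw [norm_smul, norm_div, Real.norm_of_nonneg (cutoff_nonneg _ _), Real.norm_of_nonneg (hρ x).le,
      div_mul_eq_mul_div, div_le_one (hρ x)]
    calc _ ≤ 1 * ‖x‖ := mul_le_mul_of_nonneg_right (cutoff_le_one _ _) (norm_nonneg _)
      _ ≤ _ := by rw [one_mul]; exact norm_le_regNorm δ x
  · intro x hx0 hx
    have hx' : 0 < ‖x‖ := norm_pos_iff.2 hx0
    -- Since `|x| < Λ/2` and `δ ≤ Λ/2`, `ρ² < Λ²/2 < (3Λ/4)²`, so the cutoff is still `1` at `ρ`.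
    have h1 : regNorm δ x ≤ 3 * Λ / 4 := by
      have := regNorm_sq δ x
      by_contra! h
      nlinarith [norm_nonneg x]
    simp only [q]
    rw [cutoff_eq_one hΛ h1, direction, ← sub_smul, norm_smul, ← norm_neg, neg_sub,
      Real.norm_of_nonneg]
    · have h2 := regNorm_le hδ.le x
      have h3 := norm_le_regNorm δ x
      have h4 := hρ x
      rw [le_div_iff₀ hx']
      have h5 : (‖x‖⁻¹ - 1 / regNorm δ x) * ‖x‖ * ‖x‖ = (regNorm δ x - ‖x‖) * (‖x‖ / regNorm δ x) := by
        field_simp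
      rw [h5]
      calc _ ≤ (regNorm δ x - ‖x‖) * 1 :=
            mul_le_mul_of_nonneg_left ((div_le_one h4).2 h3) (by linarith)
        _ ≤ δ := by linarith
    · rw [sub_nonneg, one_div]
      exact inv_anti₀ hx' (norm_le_regNorm δ x)
  · intro x
    have h1 : q (regNorm δ x) ≤ 1 / δ :=
      div_le_div₀ zero_le_one (cutoff_le_one _ _) hδ (le_regNorm δ x)
    calc _ ≤ ∑ i : Fin N, 1 / δ := by
          refine Finset.sum_le_sum fun i _ => ?_
          have : q' (regNorm δ x) * (x i / regNorm δ x) * x i =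
              q' (regNorm δ x) * (x i ^ 2 / regNorm δ x) := by ring
          rw [this]
          have := mul_nonpos_of_nonpos_of_nonneg (hq' _ (hρ x))
            (div_nonneg (sq_nonneg (x i)) (hρ x).le)
          linarith
      _ = _ := by simp [div_eq_mul_inv]
  · exact (contDiff_truncation Λ).continuous.comp hρc
  · intro x
    rw [← truncation_zero Λ]
    exact monotone_truncation Λ (hρ x).le
  · intro x
    have h1 := truncation_sub_le (Λ := Λ) (norm_le_regNorm δ x)
    have h2 := truncation_le_min hΛ (norm_nonneg x)
    have h3 := regNorm_le hδ.le x
    linarith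
  · intro x hx
    rw [← truncation_half hΛ]
    exact (monotone_truncation Λ (hx.trans (norm_le_regNorm δ x)))

/-! ### Gronwall argument and the differential inequality for the moment. -/

/-- The quantity `exp (-A t)(V - D/A)` starts at most at `-2γ/A` and grows by at most `C ∫ b`. Were
this less than `γ/A`, then `V T ≥ 0` would give `γ exp (A T) < D`; but `A T = D/γ` and `exp s ≥ 1 +
s`. -/
theorem le_const_mul_integral_of_deriv_le {V V' b : ℝ → ℝ} {T A C D γ V₀ : ℝ} (hA : 0 < A)
    (hγ : 0 < γ) (hC : 0 ≤ C) (hT : T = D / (γ * A)) (hT0 : 0 ≤ T)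
    (hD : D - A * V₀ = 2 * γ) (hV : ContinuousOn V (Icc 0 T)) (hb : ContinuousOn b (Icc 0 T))
    (hb0 : ∀ t ∈ Icc 0 T, 0 ≤ b t) (hVT : 0 ≤ V T) (hV0 : V 0 ≤ V₀)
    (hder : ∀ t ∈ Ioo 0 T, HasDerivAt V (V' t) t)
    (hle : ∀ t ∈ Ioo 0 T, V' t ≤ -D + A * V t + C * b t) :
    γ / A ≤ C * ∫ t in (0 : ℝ)..T, b t := by
  by_contra! hlt
  have hW : ∀ t ∈ Ioo 0 T, HasDerivAt (fun t => Real.exp (-A * t) * (V t - D / A))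
      (Real.exp (-A * t) * (-A) * (V t - D / A) + Real.exp (-A * t) * V' t) t := by
    intro t ht
    have h1 : HasDerivAt (fun t : ℝ => Real.exp (-A * t)) (Real.exp (-A * t) * (-A)) t := by
      simpa using ((hasDerivAt_id t).const_mul (-A)).exp
    exact h1.mul ((hder t ht).sub_const _)
  -- This form needs integrability only of the upper bound `C * b`, not of `V'`.
  have h2 := intervalIntegral.sub_le_integral_of_hasDeriv_right_of_le hT0
    (g := fun t => Real.exp (-A * t) * (V t - D / A)) (φ := fun t => C * b t)
    (ContinuousOn.mul (by fun_prop) (hV.sub continuousOn_const))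
    (fun t ht => (hW t ht).hasDerivWithinAt)
    ((continuousOn_const.mul hb).integrableOn_Icc) (fun t ht => by
      have h3 := hle t ht
      have h4 : Real.exp (-A * t) ≤ 1 := Real.exp_le_one_iff.2 (by nlinarith [ht.1])
      have h5 : 0 ≤ C * b t := mul_nonneg hC (hb0 t ⟨ht.1.le, ht.2.le⟩)
      have h6 : V' t - A * (V t - D / A) ≤ C * b t := by
        have : A * (D / A) = D := mul_div_cancel₀ _ hA.ne'
        linarith
      calc _ = Real.exp (-A * t) * (V' t - A * (V t - D / A)) := by ring
        _ ≤ Real.exp (-A * t) * (C * b t) := mul_le_mul_of_nonneg_left h6 (Real.exp_pos _).le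
        _ ≤ 1 * (C * b t) := mul_le_mul_of_nonneg_right h4 h5
        _ = _ := one_mul _)
  simp only [mul_zero, Real.exp_zero, one_mul] at h2
  rw [intervalIntegral.integral_const_mul] at h2
  have hDA : V₀ - D / A = -2 * (γ / A) := by
    field_simp; linarith
  have h7 : Real.exp (-A * T) * (V T - D / A) < -(γ / A) := by linarith
  have h8 : Real.exp (-A * T) * (-(D / A)) < -(γ / A) := by
    refine lt_of_le_of_lt (mul_le_mul_of_nonneg_left ?_ (Real.exp_pos _).le) h7
    linarith
  have h9 : γ < Real.exp (-A * T) * D := by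
    have : Real.exp (-A * T) * (-(D / A)) = -((Real.exp (-A * T) * D) / A) := by ring
    rw [this, neg_lt_neg_iff, div_lt_div_iff_of_pos_right hA] at h8
    exact h8
  have h10 : D / γ + 1 ≤ Real.exp (A * T) := by
    have := Real.add_one_le_exp (A * T)
    have h11 : A * T = D / γ := by rw [hT]; field_simp
    rwa [h11] at this ⊢
  have h12 : γ * Real.exp (A * T) < D := by
    have := mul_lt_mul_of_pos_right h9 (Real.exp_pos (A * T))
    rwa [mul_right_comm, ← Real.exp_add, neg_mul, neg_add_cancel, Real.exp_zero, one_mul] at this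
  have h13 : γ * (D / γ + 1) = D + γ := by field_simp
  nlinarith

theorem IsRadial.even {v : Space N → ℝ} (hv : IsRadial v) : ∀ᵐ x, v (-x) = v x := by
  obtain ⟨f, hf⟩ := hv
  have h := (Measure.measurePreserving_neg (volume : Measure (Space N))).quasiMeasurePreserving.ae hf
  filter_upwards [hf, h] with x h1 h2
  rw [h1, h2, norm_neg]

theorem IsRadialKernel.deriv_le_neg_kappa (hK : IsRadialKernel K k) {Λ s : ℝ} (hs : s ∈ Ioo 0 Λ) :
    deriv k s ≤ -kappa k Λ := by
  rw [kappa, neg_neg]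
  refine le_csSup ⟨supNormDeriv k, ?_⟩ (mem_image_of_mem _ hs)
  rintro _ ⟨r, hr, rfl⟩
  exact (le_abs_self _).trans (hK.abs_deriv_le hr.1)

theorem continuousOn_integral_mul {u : ℝ → Space N → ℝ} (hi : ∀ t, 0 ≤ t → Integrable (u t))
    (hc : ∀ t₀, 0 ≤ t₀ → Tendsto (fun t => ∫ x, |u t x - u t₀ x|) (𝓝[Ici 0] t₀) (𝓝 0))
    {φ : Space N → ℝ} {C : ℝ} (hφ : AEStronglyMeasurable φ volume) (hC : ∀ x, ‖φ x‖ ≤ C) :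
    ContinuousOn (fun t => ∫ x, u t x * φ x) (Ici 0) := by
  refine continuousOn_integral_of_continuous_L1 (Ψ := fun f => ∫ x, f x * φ x) (C := C) hi hc
    fun f g hf hg => ?_
  have h1 : ∀ {f : Space N → ℝ}, Integrable f → Integrable (fun x => f x * φ x) := fun hf =>
    hf.mul_bdd hφ (ae_of_all _ hC)
  rw [← integral_sub (h1 hf) (h1 hg), ← integral_const_mul]
  refine norm_integral_le_of_norm_le ((hf.sub hg).norm.const_mul C) (ae_of_all _ fun x => ?_)
  rw [← sub_mul, norm_mul, mul_comm]
  exact mul_le_mul_of_nonneg_right (hC x) (norm_nonneg _)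

theorem IsTruncatedNorm.norm_le {Λ δ c : ℝ} {φ : Space N → ℝ} {G : Space N → Space N}
    {l : Fin N → Space N → ℝ} (h : IsTruncatedNorm Λ δ c φ G l) (x : Space N) : ‖φ x‖ ≤ Λ + δ := by
  rw [Real.norm_of_nonneg (h.nonneg x)]
  linarith [h.le_min_add x, min_le_right ‖x‖ Λ]

theorem IsTruncatedNorm.integrable_mul {Λ δ c : ℝ} {φ : Space N → ℝ} {G : Space N → Space N}
    {l : Fin N → Space N → ℝ} (h : IsTruncatedNorm Λ δ c φ G l) {v : Space N → ℝ}
    (hv : Integrable v) : Integrable (fun x => v x * φ x) :=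
  hv.mul_bdd h.continuous.aestronglyMeasurable (ae_of_all _ h.norm_le)

theorem IsTruncatedNorm.integral_initial_le {Λ δ c : ℝ} (hΛ : 0 < Λ) {φ : Space N → ℝ}
    {G : Space N → Space N} {l : Fin N → Space N → ℝ} (h : IsTruncatedNorm Λ δ c φ G l)
    {v : Space N → ℝ} (hv : Integrable v) (hv0 : 0 ≤ᵐ[volume] v) :
    ∫ x, v x * φ x ≤ truncatedMoment v Λ + δ * mass v := by
  have h1 : Integrable (fun x => min ‖x‖ Λ * v x) := by
    refine hv.bdd_mul (c := Λ) (Continuous.aestronglyMeasurable (by fun_prop))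
      (ae_of_all _ fun x => ?_)
    rw [Real.norm_of_nonneg (le_min (norm_nonneg _) hΛ.le)]
    exact min_le_right _ _
  rw [truncatedMoment, mass, ← integral_const_mul, ← integral_add h1 (hv.const_mul δ)]
  refine integral_mono_ae (h.integrable_mul hv) (h1.add (hv.const_mul δ)) ?_
  filter_upwards [hv0] with x hx
  have := mul_le_mul_of_nonneg_left (h.le_min_add x) hx
  linarith

/-- The mass outside an annulus is controlled by the mass near the origin and the moment. -/
theorem IsTruncatedNorm.mass_compl_le {Λ δ c r : ℝ} (hΛ : 0 < Λ) {φ : Space N → ℝ}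
    {G : Space N → Space N} {l : Fin N → Space N → ℝ} (h : IsTruncatedNorm Λ δ c φ G l)
    {v : Space N → ℝ} (hv : Integrable v) (hv0 : 0 ≤ᵐ[volume] v) :
    (∫ x, v x) - ∫ x in {x | r ≤ ‖x‖ ∧ ‖x‖ < Λ / 2}, v x ≤
      (∫ x in Metric.ball (0 : Space N) r, v x) + 2 / Λ * ∫ x, v x * φ x := by
  have hAm : MeasurableSet {x : Space N | r ≤ ‖x‖ ∧ ‖x‖ < Λ / 2} :=
    (measurableSet_le measurable_const measurable_norm).inter
      (measurableSet_lt measurable_norm measurable_const)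
  rw [← integral_indicator hAm, ← integral_indicator Metric.isOpen_ball.measurableSet,
    ← integral_const_mul, ← integral_sub hv (hv.indicator hAm),
    ← integral_add (hv.indicator Metric.isOpen_ball.measurableSet)
      ((h.integrable_mul hv).const_mul _)]
  refine integral_mono_ae (hv.sub (hv.indicator hAm))
    ((hv.indicator Metric.isOpen_ball.measurableSet).add ((h.integrable_mul hv).const_mul _)) ?_
  filter_upwards [hv0] with x hx
  have hx' : 0 ≤ v x := hx
  have hφ0 : 0 ≤ 2 / Λ * (v x * φ x) :=
    mul_nonneg (by positivity) (mul_nonneg hx (h.nonneg x))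
  have hind : 0 ≤ (Metric.ball (0 : Space N) r).indicator v x := by
    by_cases hb : x ∈ Metric.ball (0 : Space N) r <;> simp [hb, hx']
  by_cases hA : x ∈ {x : Space N | r ≤ ‖x‖ ∧ ‖x‖ < Λ / 2}
  · rw [indicator_of_mem hA]; linarith
  · rw [indicator_of_notMem hA, sub_zero]
    by_cases hb : x ∈ Metric.ball (0 : Space N) r
    · rw [indicator_of_mem hb]; linarith
    · have h1 : Λ / 2 ≤ ‖x‖ := by
        by_contra! hlt
        refine hA ⟨?_, hlt⟩
        simpa using hb
      have h2 := mul_le_mul_of_nonneg_left (h.le_of_le x h1)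
        (mul_nonneg (show 0 ≤ 2 / Λ by positivity) hx')
      have h3 : 2 / Λ * v x * (Λ / 2) = v x := by field_simp
      linarith

/-- Adds the diffusion bound `ε N M / δ` to the drift bound, then trades the mass outside the
annulus for ball mass and moment. -/
theorem IsTruncatedNorm.exists_hasDerivAt (hN : 1 ≤ N) (hK : IsRadialKernel K k)
    {κ Λ δ η r c ε t M : ℝ} (hΛ : 0 < Λ) (hκ : 0 ≤ κ) (hr : 0 < r) (hη : 0 ≤ η) (hε : 0 < ε)
    (ht : 0 < t) (hk : ∀ s ∈ Ioo 0 Λ, deriv k s ≤ -κ) (hδr : δ ≤ η * r)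
    {φ : Space N → ℝ} {G : Space N → Space N} {l : Fin N → Space N → ℝ}
    (h : IsTruncatedNorm Λ δ c φ G l) {u₀ : Space N → ℝ} {u : ℝ → Space N → ℝ}
    (hu₀ : Integrable u₀) (hu : IsSolution ε K u₀ u) (hpos : ∀ t, 0 ≤ t → 0 ≤ᵐ[volume] u t)
    (hrad : ∀ t, 0 ≤ t → IsRadial (u t)) (hM : ∀ t, 0 ≤ t → ∫ x, u t x = M) :
    ∃ V', HasDerivAt (fun t => ∫ x, u t x * φ x) V' t ∧
      V' ≤ M * (ε * N / δ - κ * M / 2 + η * supNormDeriv k * M)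
        + 2 * M * (κ + 2 * supNormDeriv k) / Λ * (∫ x, u t x * φ x)
        + M * (κ + 2 * supNormDeriv k) * ∫ x in Metric.ball (0 : Space N) r, u t x := by
  have hmild := hu.isMildSolution hN hK hu₀
  have hMn : ∀ t, 0 ≤ t → ∫ x, ‖u t x‖ ≤ M := fun t ht => by
    rw [← hM t ht]
    exact (integral_congr_ae ((hpos t ht).mono fun x hx => Real.norm_of_nonneg hx)).le
  have hd := hmild.hasDerivAt_integral_mul hε ht hMn h.isTestFunction
  set V' := (∑ i, (ε * ∫ x, u t x * l i x) + ∑ i, ∫ x, (u t x • drift K (u t) x) i * G x i) with hV'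
  have hui := hu.integrable t ht.le
  have hd' : HasDerivAt (fun t => ∫ x, u t x * φ x) V' t := by
    -- The compactly supported test function is `c - φ`; since mass is conserved, `∫ u φ` is `c M`
    -- minus its pairing with `u`.
    have h1 := (hd.const_sub (c * M))
    refine (h1.congr_of_eventuallyEq ?_).congr_deriv ?_
    · filter_upwards [Ioi_mem_nhds ht] with s hs
      have hs' : 0 ≤ s := le_of_lt hs
      have h2 := hu.integrable s hs'
      simp_rw [mul_sub]
      rw [integral_sub (h2.mul_const c) (h.integrable_mul h2), integral_mul_const, hM s hs']
      ring
    · simp only [mul_neg, integral_neg, Finset.sum_neg_distrib, hV']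
      ring
  refine ⟨V', hd', ?_⟩
  have hL0 := supNormDeriv_nonneg k
  set L := supNormDeriv k
  have hM0 : 0 ≤ M := by rw [← hM t ht.le]; exact integral_nonneg_of_ae (hpos t ht.le)
  have hfl := hK.integrable_flux hN hui hui
  have hli : ∀ i, Integrable (fun x => u t x * l i x) := fun i => by
    simpa using (h.isTestFunction.integrable_mul i hui).neg
  have hlap : ∑ i, (ε * ∫ x, u t x * l i x) ≤ ε * N / δ * M := by
    rw [← Finset.mul_sum, ← integral_finsetSum _ fun i _ => hli i, mul_div_assoc, mul_assoc,
      ← hM t ht.le]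
    refine mul_le_mul_of_nonneg_left ?_ hε.le
    rw [← integral_const_mul]
    refine integral_mono_ae (integrable_finsetSum _ fun i _ => hli i) (hui.const_mul _) ?_
    filter_upwards [hpos t ht.le] with x hx
    rw [← Finset.mul_sum, mul_comm]
    exact mul_le_mul_of_nonneg_right (h.laplacian_le x) hx
  have hGI : ∀ i : Fin N, Integrable (fun x => (u t x • drift K (u t) x) i * G x i) := fun i => by
    refine (integrable_component hfl i).mul_bdd (c := 1) ?_ (ae_of_all _ fun x => ?_)
    · have h1 := h.measurable_gradient
      exact Measurable.aestronglyMeasurable (by fun_prop)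
    · exact (PiLp.norm_apply_le _ _).trans (h.norm_gradient_le x)
  have hinner : ∑ i, ∫ x, (u t x • drift K (u t) x) i * G x i
      = ∫ x, ⟪G x, u t x • drift K (u t) x⟫ := by
    rw [← integral_finsetSum _ fun i _ => hGI i]
    refine integral_congr_ae (ae_of_all _ fun x => ?_)
    simp [PiLp.inner_apply]
  -- On the annulus the direction error `δ/|x|` is at most `δ/r ≤ η`.
  have hint := integral_inner_drift_le hN hK hκ hr hη hk h.measurable_gradient
    h.norm_gradient_le (A := {x | r ≤ ‖x‖ ∧ ‖x‖ < Λ / 2}) rfl (fun x hx => by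
      have hx0 : 0 < ‖x‖ := hr.trans_le hx.1
      refine (h.gradient_sub_direction x (norm_pos_iff.1 hx0) hx.2).trans ?_
      rw [div_le_iff₀ hx0]
      exact hδr.trans (mul_le_mul_of_nonneg_left hx.1 hη)) hui (hpos t ht.le) (hrad t ht.le).even
  have hmass := h.mass_compl_le (r := r) hΛ hui (hpos t ht.le)
  rw [hM t ht.le] at hint hmass
  have h5 := mul_le_mul_of_nonneg_left hmass
    (mul_nonneg hM0 (show 0 ≤ κ + 2 * L by linarith))
  rw [hV', hinner]
  refine (add_le_add hlap hint).trans ?_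
  calc _ = M * (ε * N / δ - κ * M / 2 + η * L * M) + M * (κ + 2 * L) *
        (M - ∫ x in {x | r ≤ ‖x‖ ∧ ‖x‖ < Λ / 2}, u t x) := by ring
    _ ≤ _ := by
      refine (add_le_add_right h5 _).trans_eq ?_
      ring

theorem IsSolution.integral_eq_mass (hN : 1 ≤ N) (hK : IsRadialKernel K k) {ε : ℝ} (hε : 0 < ε)
    {u₀ : Space N → ℝ} {u : ℝ → Space N → ℝ} (hu₀ : Integrable u₀) (hu : IsSolution ε K u₀ u)
    {t : ℝ} (ht : 0 ≤ t) : ∫ x, u t x = mass u₀ := by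
  rcases ht.eq_or_lt with rfl | ht
  · exact integral_congr_ae hu.initial
  · exact (hu.isMildSolution hN hK hu₀).integral_eq hε ht

end Aggregation

end

/-! ### Choice of constants and conclusion. -/

theorem mainTheorem1 (N : ℕ) (hN : 1 ≤ N)
    (K : Aggregation.Space N → ℝ) (k : ℝ → ℝ)
    (hK : Aggregation.IsRadialKernel K k)
    (hsing : Aggregation.IsMildlySingular k)
    (hk'' : N = 1 → Aggregation.SecondDerivIntegrable k)
    (u₀ : Aggregation.Space N → ℝ)
    (hu₀ : Aggregation.IsInitialDatum u₀)
    (hu₀rad : Aggregation.IsRadial u₀)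
    (Λ : ℝ) (hΛ : 0 < Λ)
    (hμ : Aggregation.truncatedMoment u₀ Λ <
      Aggregation.kappa k Λ * Aggregation.mass u₀ /
        (4 * (Aggregation.kappa k Λ + 2 * Aggregation.supNormDeriv k)) * Λ) :
    ∃ εs Ts Cs lam : ℝ, 0 < εs ∧ 0 < Ts ∧ 0 < Cs ∧ 0 < lam ∧
      ∀ ε : ℝ, 0 < ε → ε < εs →
        ∀ u : ℝ → Aggregation.Space N → ℝ,
          Aggregation.IsSolution ε K u₀ u →
          (∀ t, 0 ≤ t → 0 ≤ᵐ[volume] u t) →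
          (∀ t, 0 ≤ t → Aggregation.IsRadial (u t)) →
          Cs ≤ ∫ t in (0 : ℝ)..Ts, ∫ x in Metric.ball (0 : Aggregation.Space N) (lam * ε), u t x := by
  have hκ := hsing.kappa_pos Λ hΛ
  have hk : ∀ s ∈ Ioo 0 Λ, deriv k s ≤ -Aggregation.kappa k Λ := fun s hs =>
    hK.deriv_le_neg_kappa hs
  have hL := Aggregation.supNormDeriv_nonneg k
  have hM := hu₀.mass_pos
  have hμ0 : 0 ≤ Aggregation.truncatedMoment u₀ Λ :=
    integral_nonneg_of_ae (hu₀.nonneg.mono fun x hx => mul_nonneg (le_min (norm_nonneg _) hΛ.le) hx)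
  set κ := Aggregation.kappa k Λ
  set L := Aggregation.supNormDeriv k with hLdef
  set M := Aggregation.mass u₀
  set μ := Aggregation.truncatedMoment u₀ Λ
  have hκL : 0 < κ + 2 * L := by linarith
  -- The moment hypothesis is exactly `Δ > 0`; `M Δ` is the initial decay rate of the moment when
  -- smoothing errors, diffusion and ball mass are neglected. The choices of `η`, `lam'` and `δ₀`
  -- cost at most `MΔ/8` (direction error), `MΔ/8` (diffusion) and `MΔ/4` (initial moment), leaving
  -- `MΔ/2 = 2γ`.
  obtain ⟨Δ, hΔ⟩ : ∃ Δ, Δ = κ * M / 2 - 2 * (κ + 2 * L) * μ / Λ := ⟨_, rfl⟩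
  have hΔ0 : 0 < Δ := by
    rw [hΔ, sub_pos, div_lt_iff₀ hΛ]
    calc 2 * (κ + 2 * L) * μ < 2 * (κ + 2 * L) * (κ * M / (4 * (κ + 2 * L)) * Λ) :=
          mul_lt_mul_of_pos_left hμ (by positivity)
      _ = _ := by field_simp; ring
  -- The `+ 1` keeps the denominator positive using only `L ≥ 0`.
  set η := Δ / (8 * (L * M + 1)) with hηdef
  have hη : 0 < η := by positivity
  have hηLM : η * L * M ≤ Δ / 8 := by
    rw [hηdef, div_mul_eq_mul_div, div_mul_eq_mul_div, div_le_div_iff₀ (by positivity) (by positivity)]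
    nlinarith
  set lam' := 8 * (N + 1) / Δ with hlam'
  have hlam'0 : 0 < lam' := by positivity
  have hNlam : N / lam' ≤ Δ / 8 := by
    rw [hlam', div_div_eq_mul_div, div_le_div_iff₀ (by positivity) (by positivity)]
    nlinarith
  set δ₀ := Δ * Λ / (8 * (κ + 2 * L) * M) with hδ₀def
  have hδ₀ : 0 < δ₀ := by positivity
  set A := 2 * M * (κ + 2 * L) / Λ with hA
  have hA0 : 0 < A := by positivity
  set D := M * (κ * M / 2 - Δ / 4) with hDdef
  set γ := M * Δ / 4 with hγdef
  have hγ : 0 < γ := by positivity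
  have hD : D - A * (μ + δ₀ * M) = 2 * γ := by
    have h1 : A * (δ₀ * M) = M * Δ / 4 := by
      rw [hA, hδ₀def]; field_simp; norm_num
    have h2 : A * μ = M * (2 * (κ + 2 * L) * μ / Λ) := by rw [hA]; ring
    rw [mul_add, h1, h2, hγdef, hDdef]
    linear_combination (-M) * hΔ
  have hD0 : 0 < D := by nlinarith [mul_nonneg hA0.le (add_nonneg hμ0 (mul_nonneg hδ₀.le hM.le))]
  set C := M * (κ + 2 * L) with hCdef
  have hC : 0 < C := by positivity
  -- The smoothing scale is `δ = lam' ε` and the inner radius is `r = (lam'/η) ε`, so that `δ = η r`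
  -- and `ε/δ = 1/lam'`. The threshold on `ε` ensures both `δ ≤ Λ/2` and `δ ≤ δ₀`.
  refine ⟨min (Λ / 2) δ₀ / lam', D / (γ * A), γ / A / C, lam' / η, by positivity, by positivity,
    by positivity, by positivity, fun ε hε hεs u hu hpos hrad => ?_⟩
  have hδ : lam' * ε < min (Λ / 2) δ₀ := by
    rw [mul_comm]; exact (lt_div_iff₀ hlam'0).1 hεs
  have hδ1 : lam' * ε ≤ Λ / 2 := hδ.le.trans (min_le_left _ _)
  have hδ2 : lam' * ε ≤ δ₀ := hδ.le.trans (min_le_right _ _)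
  have hδpos : 0 < lam' * ε := by positivity
  obtain ⟨c, φ, G, l, hφ⟩ := Aggregation.exists_isTruncatedNorm (N := N) hΛ hδpos hδ1
  have hmass : ∀ t, 0 ≤ t → ∫ x, u t x = M := fun t ht =>
    hu.integral_eq_mass hN hK hε hu₀.integrable ht
  have hder := fun t (ht : 0 < t) => hφ.exists_hasDerivAt hN hK hΛ hκ.le
    (r := lam' / η * ε) (by positivity) hη.le hε ht hk
    (by rw [← mul_assoc, mul_div_cancel₀ _ hη.ne']) hu₀.integrable hu hpos hrad hmass
  choose! V' hV' hV'le using hder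
  rw [div_le_iff₀ hC, mul_comm]
  have hball : ContinuousOn (fun t => ∫ x in Metric.ball (0 : Aggregation.Space N) (lam' / η * ε), u t x)
      (Ici 0) := by
    have hm : MeasurableSet (Metric.ball (0 : Aggregation.Space N) (lam' / η * ε)) :=
      Metric.isOpen_ball.measurableSet
    have h1 := Aggregation.continuousOn_integral_mul hu.integrable hu.continuous_L1 (C := 1)
      (φ := (Metric.ball (0 : Aggregation.Space N) (lam' / η * ε)).indicator 1)
      (measurable_one.indicator hm).aestronglyMeasurable fun x => by
        by_cases hx : x ∈ Metric.ball (0 : Aggregation.Space N) (lam' / η * ε)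
        · rw [indicator_of_mem hx]; simp
        · rw [indicator_of_notMem hx]; simp
    refine h1.congr fun t _ => ?_
    simp only
    rw [← integral_indicator hm]
    refine integral_congr_ae (ae_of_all _ fun x => ?_)
    by_cases hx : x ∈ Metric.ball (0 : Aggregation.Space N) (lam' / η * ε)
    · simp only [indicator_of_mem hx, Pi.one_apply, mul_one]
    · simp only [indicator_of_notMem hx, mul_zero]
  refine Aggregation.le_const_mul_integral_of_deriv_le (V := fun t => ∫ x, u t x * φ x) (V' := V')
    hA0 hγ hC.le rfl (by positivity) hD ?_ (hball.mono Icc_subset_Ici_self) ?_ ?_ ?_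
    (fun t ht => hV' t ht.1) fun t ht => ?_
  · exact (Aggregation.continuousOn_integral_mul hu.integrable hu.continuous_L1
      hφ.continuous.aestronglyMeasurable hφ.norm_le).mono Icc_subset_Ici_self
  · exact fun t ht => setIntegral_nonneg_of_ae (hpos t ht.1)
  · exact integral_nonneg_of_ae ((hpos _ (by positivity)).mono
      fun x hx => mul_nonneg hx (hφ.nonneg x))
  · have h1 : ∫ x, u 0 x * φ x = ∫ x, u₀ x * φ x :=
      integral_congr_ae (hu.initial.mono fun x hx => by simp only [hx])
    have h2 := hφ.integral_initial_le hΛ hu₀.integrable hu₀.nonneg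
    have h3 := mul_le_mul_of_nonneg_right hδ2 hM.le
    simp only [h1]
    linarith
  · refine (hV'le t ht.1).trans ?_
    have h1 : ε * N / (lam' * ε) = N / lam' := by
      field_simp
    have h2 : M * (ε * N / (lam' * ε) - κ * M / 2 + η * L * M) ≤ -D := by
      rw [h1, hDdef, ← mul_neg]
      exact mul_le_mul_of_nonneg_left (by linarith) hM.le
    linarith
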